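/- Let $(\mathcal X,d)$ be a compact metric space, let $C:\mathcal X\times\mathcal X\to\mathbb R$ be $L$-Lipschitz, and let $\alpha,\beta$ be Borel probability measures on $\mathcal X$. For a probability measure $\mu$ and a continuous function $h$ write $$T_\mu(h)(x)=-\log\int e^{h(y)-C(x,y)}\,d\mu(y),\qquad \check T_\mu(h)(y)=-\log\int e^{h(x)-C(x,y)}\,d\mu(x)$$ for the soft $C$-transforms in the two variables (they coincide if $C$ is symmetric), and $\|f\|_{\mathrm{var}}=\max f-\min f$. Let $(f^\star,g^\star)$ be optimal potentials, that is, a maximizer over $\mathcal C(\mathcal X)^2$ of the dual of entropy-regularized optimal transport, $$(f,g)\mapsto\int f\,d\alpha+\int g\,d\beta-\iint e^{f(x)+g(y)-C(x,y)}\,d\alpha(x)\,d\beta(y)+1,$$ where, if the supports of $\alpha$, $\beta$ are not all of $\mathcal X$, the values that the dual leaves free are fixed by the optimality equations: $f^\star=T_\beta(g^\star)$ outside $\operatorname{supp}\alpha$ and $g^\star=\check T_\alpha(f^\star)$ outside $\operatorname{supp}\beta$. Let $(x_i,y_i)_{i\ge1}$ be independent random pairs with $x_i\sim\alpha$ and $y_i\sim\beta$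 (for instance, two independent i.i.d. streams of samples). Let $n(t)\in\mathbb N$, $t\ge0$, be batch sizes, put $n_0=0$, $n_{t+1}=n_t+n(t)$, and let $$\hat\alpha_t=\frac1{n(t)}\sum_{i=n_t+1}^{n_{t+1}}\delta_{x_i},\qquad \hat\beta_t=\frac1{n(t)}\sum_{i=n_t+1}^{n_{t+1}}\delta_{y_i}.$$ Let $\hat f_0,\hat g_0$ be continuous initial potentials, deterministic or random and independent of the samples. The online Sinkhorn iterates with step sizes $(\eta_t)_{t\ge0}$ are defined by the simultaneous updates $$e^{-\hat f_{t+1}}=(1-\eta_t)e^{-\hat f_t}+\eta_t e^{-T_{\hat\beta_t}(\hat g_t)},\qquad e^{-\hat g_{t+1}}=(1-\eta_t)e^{-\hat g_t}+\eta_t e^{-\check T_{\hat\alpha_t}(\hat f_t)}.$$ Assume that there are $B>0$ and $w_t>0$ such that, for all $t$, $n(t)=B/w_t^2\in\mathbb N$ and $0\le\eta_t\le1$, and that $\sum_t w_t\eta_t<\infty$ and $\sum_t\eta_t=\infty$. Then, almost surely, $$\|\hat f_t-f^\star\|_{\mathrm{var}}+\|\hat g_t-g^\star\|_{\mathrm{var}}\longrightarrow0\qquad(t\to\infty).$$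 -/

import Mathlib

open MeasureTheory ProbabilityTheory Filter Topology

noncomputable section

namespace OnlineSinkhorn

variable {X : Type*}

/-- The variation seminorm `max f - min f` (for a continuous function on a nonempty compact space
the supremum and the infimum are attained). -/
def varNorm (f : X → ℝ) : ℝ := (⨆ x, f x) - ⨅ x, f x

/-- The soft `C`-transform `x ↦ -log ∫ exp (h y - C x y) dμ(y)`. The variable that is integrated is
the second argument of the cost; for the other variable, use the cost `flip C`. -/
def softCTransform [MeasurableSpace X] (C : X → X → ℝ) (h : X → ℝ) (μ : Measure X) (x : X) : ℝ :=
  -Real.log (∫ y, Real.exp (h y - C x y) ∂μ)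

/-- The objective of the dual of entropy-regularized optimal transport (regularization `1`). -/
def dualObjective [MeasurableSpace X] (C : X → X → ℝ) (α β : Measure X) (f g : X → ℝ) : ℝ :=
  (∫ x, f x ∂α) + (∫ y, g y ∂β)
    - (∫ p : X × X, Real.exp (f p.1 + g p.2 - C p.1 p.2) ∂(α.prod β)) + 1

/-- Optimal potentials: a pair of continuous functions that maximizes the dual objective among all
pairs of continuous functions. The dual objective does not see the values of `f` outside the support
of `α` and those of `g` outside the support of `β`; there the potentials are given by the
optimality equations `f = softCTransform g β` and `g = softCTransform f α`. (When both supports are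
the whole space the last two fields are void.) -/
structure IsOptimalPotentials [TopologicalSpace X] [MeasurableSpace X] (C : X → X → ℝ)
    (α β : Measure X) (f g : X → ℝ) : Prop where
  continuous_left : Continuous f
  continuous_right : Continuous g
  isMax : ∀ f' g' : X → ℝ, Continuous f' → Continuous g' →
    dualObjective C α β f' g' ≤ dualObjective C α β f g
  left_off_support : ∀ x, x ∉ α.support → f x = softCTransform C g β x
  right_off_support : ∀ y, y ∉ β.support → g y = softCTransform (flip C) f α y

/-- The number of samples drawn before iteration `t`, when iteration `s` draws `n s` of them. -/
def samplesBefore (n : ℕ → ℕ) (t : ℕ) : ℕ := ∑ s ∈ Finset.range t, n s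

/-- The empirical measure of the `t`-th mini-batch of the stream `z`; its size is `n t`. -/
def batchMeasure [MeasurableSpace X] (n : ℕ → ℕ) (z : ℕ → X) (t : ℕ) : Measure X :=
  (n t : ENNReal)⁻¹ •
    ∑ i ∈ Finset.Ico (samplesBefore n t) (samplesBefore n (t + 1)), Measure.dirac (z i)

/-- The online Sinkhorn iterates for the step sizes `η`, the batch sizes `n`, the sample streams
`x` and `y` and the initial potentials `f₀` and `g₀`: both potentials are updated simultaneously, by
`exp (-f (t+1)) = (1 - η t) exp (-f t) + η t exp (-(soft C-transform of g t for the batch of y))`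
and symmetrically for `g`. -/
def iterates [MeasurableSpace X] (C : X → X → ℝ) (η : ℕ → ℝ) (n : ℕ → ℕ) (x y : ℕ → X)
    (f₀ g₀ : X → ℝ) : ℕ → (X → ℝ) × (X → ℝ)
  | 0 => (f₀, g₀)
  | t + 1 =>
    let f := (iterates C η n x y f₀ g₀ t).1
    let g := (iterates C η n x y f₀ g₀ t).2
    (fun a => -Real.log ((1 - η t) * Real.exp (-f a)
        + η t * Real.exp (-softCTransform C g (batchMeasure n y t) a)),
     fun b => -Real.log ((1 - η t) * Real.exp (-g b)
        + η t * Real.exp (-softCTransform (flip C) f (batchMeasure n x t) b)))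

end OnlineSinkhorn

end

/-! Work with the ratios `a t = exp (fstar - f t)` and `b t = exp (gstar - g t)`. By the Euler
equations, `π x y = exp (fstar x + gstar y - C x y)` integrates to one in each variable. It is
bounded below by some `δ > 0`, and the update becomes `a ↦ (1 - η) a + η ∫ π / b` over the batch,
symmetrically for `b`. The claim is that the oscillation `d` in `a x ≤ (1 + d) * a x'`, and likewise
for `b`, tends to zero.

Without noise this is Doeblin's argument: the part `δ` common to all rows of `π` cancels in
differences, and `d` shrinks by a factor `1 - c η` (`left_succ_le_contraction`). As `∑ η = ∞`,
errors that are summable against `η` do no harm (`eventually_le_of_contraction`). Three points need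
care.

Scale. The rate `c` and the effect of the errors depend on the size of `a` and `b`, which the
invariance under `(f + c, g - c)` leaves free. Oscillations are bounded for any batches
(`exists_oscillation_bound`). The integrals `∫ 1 / a dα` and `∫ b dβ` scale alike under the
invariance; Jensen's inequality and the marginals of `π` show that their maximum grows at most by
factors `1 + r t` with `∑ r t < ∞`. The mirror image bounds `∫ 1 / b dβ` and `∫ a dα`.

Noise. The error of a batch, multiplied by `b t x₀`, does not depend on the scale of `b t`. The
batch is independent of the current potentials, so the variance bounds its mean by a multiple of
`n(t)^(-1/2)`, hence of `w t`. Since `∑ w η < ∞`, the weighted errors are almost surely summable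
(`ae_summable_sampling_error`), without any prior bound on the scale.

Uniformity. This is applied only to averages over `α` and `β` and to the points of a countable dense
set. Once the scale is bounded, the errors are equicontinuous, and a finite net controls their
suprema up to a term `η t * ε` that the contraction absorbs. -/

namespace OnlineSinkhorn

/-! ### Integrals on compact spaces and scalar recursions. -/

section Calculus

variable {X : Type*} [TopologicalSpace X] [CompactSpace X] [MeasurableSpace X]
  [OpensMeasurableSpace X]

lemma _root_.Continuous.integrable_of_compactSpace {f : X → ℝ} (hf : Continuous f)
    (μ : Measure X) [IsFiniteMeasure μ] : Integrable f μ :=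
  (BoundedContinuousFunction.mkOfCompact ⟨f, hf⟩).integrable μ

lemma integral_le_of_forall_le {f : X → ℝ} (hf : Continuous f) (μ : Measure X)
    [IsProbabilityMeasure μ] {c : ℝ} (h : ∀ x, f x ≤ c) : ∫ x, f x ∂μ ≤ c := by
  simpa using integral_mono (hf.integrable_of_compactSpace μ) (integrable_const c) h

lemma le_integral_of_forall_le {f : X → ℝ} (hf : Continuous f) (μ : Measure X)
    [IsProbabilityMeasure μ] {c : ℝ} (h : ∀ x, c ≤ f x) : c ≤ ∫ x, f x ∂μ := by
  simpa using integral_mono (integrable_const c) (hf.integrable_of_compactSpace μ) h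

end Calculus

lemma inv_convex_combination_le {η p q : ℝ} (h0 : 0 ≤ η) (h1 : η ≤ 1) (hp : 0 < p) (hq : 0 < q) :
    ((1 - η) * p + η * q)⁻¹ ≤ (1 - η) * p⁻¹ + η * q⁻¹ := by
  have h := (convexOn_zpow (-1)).2 (x := p) (y := q) hp hq (sub_nonneg.2 h1) h0 (by ring)
  simpa using h

/-- A nonnegative sequence whose growth factors `1 + r t` have a summable excess is bounded. -/
lemma exists_bound_of_le_mul_one_add {M r : ℕ → ℝ} (hM : ∀ t, 0 ≤ M t) (hr : ∀ t, 0 ≤ r t)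
    (hs : Summable r) (h : ∀ t, M (t + 1) ≤ M t * (1 + r t)) : ∃ K, ∀ t, M t ≤ K := by
  refine ⟨M 0 * Real.exp (∑' t, r t), fun t => ?_⟩
  have key : M t ≤ M 0 * Real.exp (∑ i ∈ Finset.range t, r i) := by
    induction t with
    | zero => simp
    | succ t ih =>
      rw [Finset.sum_range_succ, Real.exp_add, ← mul_assoc]
      refine (h t).trans (mul_le_mul ih ?_ (by linarith [hr t]) ((hM t).trans ih))
      linarith [Real.add_one_le_exp (r t)]
  refine key.trans (mul_le_mul_of_nonneg_left ?_ (hM 0))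
  exact Real.exp_le_exp.2 (hs.sum_le_tsum _ fun i _ => hr i)

/-- A contraction by `1 - c * η t` with a summable perturbation and a perturbation that is at most
`η t * ε`. -/
lemma eventually_le_of_contraction {d η s : ℕ → ℝ} {c ε : ℝ} (hc : 0 < c) (hε : 0 < ε)
    (hη0 : ∀ t, 0 ≤ η t) (hcη : ∀ t, c * η t ≤ 1) (hs0 : ∀ t, 0 ≤ s t) (hs : Summable s)
    (hη : Tendsto (fun T => ∑ t ∈ Finset.range T, η t) atTop atTop)
    (h : ∀ t, d (t + 1) ≤ (1 - c * η t) * d t + s t + η t * ε) :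
    ∀ᶠ t in atTop, d t ≤ 2 * (ε / c) := by
  -- The level `ε / c` is fixed by `d ↦ (1 - c * η) * d + η * ε` whatever the step, so the excess
  -- over it decays and collects only `s`.
  set e : ℕ → ℝ := fun t => max (d t - ε / c) 0 with he
  have he0 : ∀ t, 0 ≤ e t := fun t => le_max_right _ _
  have hstep : ∀ t, e (t + 1) ≤ Real.exp (-(c * η t)) * e t + s t := by
    intro t
    have h1 : 0 ≤ 1 - c * η t := by linarith [hcη t]
    have h2 : 1 - c * η t ≤ Real.exp (-(c * η t)) := by
      linarith [Real.add_one_le_exp (-(c * η t))]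
    have h3 := mul_le_mul_of_nonneg_right h2 (he0 t)
    have h4 : d t - ε / c ≤ e t := le_max_left _ _
    have h5 := mul_le_mul_of_nonneg_left h4 h1
    have h6 : c * η t * (ε / c) = η t * ε := by field_simp
    refine max_le ?_ ?_
    · nlinarith [h t]
    · have := mul_nonneg (Real.exp_pos (-(c * η t))).le (he0 t)
      linarith [hs0 t]
  have hunroll : ∀ T k, e (T + k) ≤
      Real.exp (-(c * (∑ i ∈ Finset.range (T + k), η i - ∑ i ∈ Finset.range T, η i))) * e T
        + ∑ i ∈ Finset.range k, s (i + T) := by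
    intro T k
    induction k with
    | zero => simp
    | succ k ih =>
      rw [← add_assoc, Finset.sum_range_succ (n := T + k), Finset.sum_range_succ (n := k)]
      have h1 : Real.exp (-(c * η (T + k))) ≤ 1 := by
        rw [Real.exp_le_one_iff]; nlinarith [hη0 (T + k)]
      have h2 := mul_le_mul_of_nonneg_left ih (Real.exp_pos (-(c * η (T + k)))).le
      have h3 : 0 ≤ ∑ i ∈ Finset.range k, s (i + T) := Finset.sum_nonneg fun i _ => hs0 _
      have h4 := mul_le_mul_of_nonneg_right h1 h3
      have h5 : Real.exp (-(c * (∑ i ∈ Finset.range (T + k), η i + η (T + k)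
          - ∑ i ∈ Finset.range T, η i))) = Real.exp (-(c * η (T + k))) *
          Real.exp (-(c * (∑ i ∈ Finset.range (T + k), η i - ∑ i ∈ Finset.range T, η i))) := by
        rw [← Real.exp_add]; ring_nf
      rw [h5, add_comm k T]
      have := hstep (T + k)
      linarith
  have hδ : 0 < ε / c / 2 := by positivity
  -- After a late time `T` the remaining `s` add less than `ε / c / 2`; divergence of `∑ η` then
  -- makes the memory of `e T` smaller than `ε / c / 2` too.
  have htail := (tendsto_sum_nat_add s).eventually_lt_const hδ
  obtain ⟨T, hT⟩ := htail.exists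
  have hexp : Tendsto (fun t => Real.exp (-(c * (∑ i ∈ Finset.range t, η i
      - ∑ i ∈ Finset.range T, η i))) * e T) atTop (𝓝 (0 * e T)) := by
    refine Tendsto.mul_const _ (Real.tendsto_exp_atBot.comp ?_)
    refine tendsto_neg_atTop_atBot.comp (Tendsto.const_mul_atTop hc ?_)
    exact tendsto_atTop_add_const_right _ _ hη
  rw [zero_mul] at hexp
  filter_upwards [hexp.eventually_lt_const hδ, eventually_ge_atTop T] with t h1 h2
  obtain ⟨k, rfl⟩ := Nat.exists_eq_add_of_le h2
  have h3 := hunroll T k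
  have h4 : ∑ i ∈ Finset.range k, s (i + T) ≤ ∑' i, s (i + T) :=
    ((summable_nat_add_iff T).2 hs).sum_le_tsum _ fun i _ => hs0 _
  have h5 : d (T + k) - ε / c ≤ e (T + k) := le_max_left _ _
  linarith

/-! ### Relative iterates and their oscillation. -/

/-- Sinkhorn iterates `a = exp (-f) / exp (-fstar)` and `b = exp (-g) / exp (-gstar)` relative to the
optimal potentials. The kernel `π` is the density of the optimal plan with respect to the product of
its marginals `α` and `β`. -/
structure RelativeIterates {X : Type*} [TopologicalSpace X] [MeasurableSpace X] (π : X → X → ℝ)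
    (α β : Measure X) (αs βs : ℕ → Measure X) (η : ℕ → ℝ) (δ Λ : ℝ) (a b : ℕ → X → ℝ) : Prop where
  continuous_kernel : Continuous fun p : X × X => π p.1 p.2
  kernel_pos : 0 < δ
  le_kernel : ∀ x y, δ ≤ π x y
  kernel_le : ∀ x y, π x y ≤ Λ
  marginal_left : ∀ x, ∫ y, π x y ∂β = 1
  marginal_right : ∀ y, ∫ x, π x y ∂α = 1
  step_nonneg : ∀ t, 0 ≤ η t
  step_le_one : ∀ t, η t ≤ 1
  continuous_left : ∀ t, Continuous (a t)
  continuous_right : ∀ t, Continuous (b t)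
  left_pos : ∀ t x, 0 < a t x
  right_pos : ∀ t y, 0 < b t y
  left_succ : ∀ t x, a (t + 1) x = (1 - η t) * a t x + η t * ∫ y, π x y / b t y ∂(βs t)
  right_succ : ∀ t y, b (t + 1) y = (1 - η t) * b t y + η t * ∫ x, π x y / a t x ∂(αs t)

/-- The error made by replacing `β` by `ν` in the update. -/
noncomputable def samplingError {X : Type*} [MeasurableSpace X] (π : X → X → ℝ) (β ν : Measure X)
    (b : X → ℝ) (x : X) : ℝ :=
  ∫ y, π x y / b y ∂ν - ∫ y, π x y / b y ∂β

namespace RelativeIterates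

variable {X : Type*} [TopologicalSpace X] [MeasurableSpace X]
  {π : X → X → ℝ} {α β : Measure X} {αs βs : ℕ → Measure X} {η : ℕ → ℝ} {δ Λ : ℝ}
  {a b : ℕ → X → ℝ}

/-- The two potentials play the same role, so each estimate that follows is proved for one of them
and transferred by this exchange. -/
lemma symm (h : RelativeIterates π α β αs βs η δ Λ a b) :
    RelativeIterates (flip π) β α βs αs η δ Λ b a where
  continuous_kernel := h.continuous_kernel.comp continuous_swap
  kernel_pos := h.kernel_pos
  le_kernel x y := h.le_kernel y x
  kernel_le x y := h.kernel_le y x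
  marginal_left := h.marginal_right
  marginal_right := h.marginal_left
  step_nonneg := h.step_nonneg
  step_le_one := h.step_le_one
  continuous_left := h.continuous_right
  continuous_right := h.continuous_left
  left_pos := h.right_pos
  right_pos := h.left_pos
  left_succ := h.right_succ
  right_succ := h.left_succ

lemma continuous_kernel_right (h : RelativeIterates π α β αs βs η δ Λ a b) (x : X) :
    Continuous (π x) :=
  h.continuous_kernel.comp (Continuous.prodMk_right x)

lemma continuous_integrand (h : RelativeIterates π α β αs βs η δ Λ a b) (t : ℕ) :
    Continuous fun p : X × X => π p.1 p.2 / b t p.2 :=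
  h.continuous_kernel.div ((h.continuous_right t).comp continuous_snd)
    fun p => (h.right_pos t p.2).ne'

lemma continuous_integrand_right (h : RelativeIterates π α β αs βs η δ Λ a b) (t : ℕ) (x : X) :
    Continuous fun y => π x y / b t y :=
  (h.continuous_integrand t).comp (Continuous.prodMk_right x)

end RelativeIterates

lemma continuous_integral_right {X : Type*} [MetricSpace X] [CompactSpace X] [MeasurableSpace X]
    [BorelSpace X] {F : X → X → ℝ} (hF : Continuous fun p : X × X => F p.1 p.2) (μ : Measure X)
    [IsFiniteMeasure μ] : Continuous fun x => ∫ y, F x y ∂μ := by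
  have := continuous_parametric_integral_of_continuous (μ := μ) (f := F) hF isCompact_univ
  simpa using this

lemma integral_integral_swap_of_continuous {X : Type*} [MetricSpace X] [CompactSpace X]
    [MeasurableSpace X] [BorelSpace X] {F : X → X → ℝ}
    (hF : Continuous fun p : X × X => F p.1 p.2) (μ ν : Measure X) [IsFiniteMeasure μ]
    [IsFiniteMeasure ν] : ∫ x, ∫ y, F x y ∂ν ∂μ = ∫ y, ∫ x, F x y ∂μ ∂ν :=
  integral_integral_swap (hF.integrable_of_compactSpace (μ.prod ν))

namespace RelativeIterates

variable {X : Type*} [MetricSpace X] [CompactSpace X] [MeasurableSpace X] [BorelSpace X]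
  {π : X → X → ℝ} {α β : Measure X} {αs βs : ℕ → Measure X} {η : ℕ → ℝ} {δ Λ : ℝ}
  {a b : ℕ → X → ℝ}

lemma continuous_update (h : RelativeIterates π α β αs βs η δ Λ a b) (t : ℕ) (μ : Measure X)
    [IsFiniteMeasure μ] : Continuous fun x => ∫ y, π x y / b t y ∂μ :=
  continuous_integral_right (F := fun x y => π x y / b t y) (h.continuous_integrand t) μ

lemma continuous_samplingError [IsProbabilityMeasure β] [∀ t, IsProbabilityMeasure (βs t)]
    (h : RelativeIterates π α β αs βs η δ Λ a b) (t : ℕ) :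
    Continuous (samplingError π β (βs t) (b t)) :=
  (h.continuous_update t (βs t)).sub (h.continuous_update t β)

/-- One half of the bound on the oscillation of the iterates. -/
lemma left_succ_le_mul [∀ t, IsProbabilityMeasure (βs t)]
    (h : RelativeIterates π α β αs βs η δ Λ a b) {K : ℝ} (hK : Λ ≤ K * δ) {t : ℕ}
    (ha : ∀ x x', a t x ≤ K * a t x') (x x' : X) : a (t + 1) x ≤ K * a (t + 1) x' := by
  rw [h.left_succ, h.left_succ]
  have h1 : ∫ y, π x y / b t y ∂(βs t) ≤ K * ∫ y, π x' y / b t y ∂(βs t) := by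
    rw [← integral_const_mul]
    refine integral_mono ((h.continuous_integrand_right t x).integrable_of_compactSpace _)
      (((h.continuous_integrand_right t x').const_mul K).integrable_of_compactSpace _) fun y => ?_
    have hK0 : 0 ≤ K := by
      have h2 : 0 < Λ := h.kernel_pos.trans_le ((h.le_kernel x y).trans (h.kernel_le x y))
      by_contra hneg
      nlinarith [h.kernel_pos]
    have : π x y ≤ K * π x' y := (h.kernel_le x y).trans
      (hK.trans (mul_le_mul_of_nonneg_left (h.le_kernel x' y) hK0))
    change π x y / b t y ≤ K * (π x' y / b t y)
    rw [← mul_div_assoc]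
    exact div_le_div_of_nonneg_right this (h.right_pos t y).le
  nlinarith [mul_le_mul_of_nonneg_left h1 (h.step_nonneg t),
    mul_le_mul_of_nonneg_left (ha x x') (sub_nonneg.2 (h.step_le_one t))]

/-- Two rows of `π` have ratio at most `Λ / δ`, so every fresh update has oscillation at most `Λ /
δ` whatever the batch and the scale, and convex combinations preserve such a bound. The constant `K`
also covers the initial functions. -/
lemma exists_oscillation_bound [Nonempty X] [∀ t, IsProbabilityMeasure (αs t)]
    [∀ t, IsProbabilityMeasure (βs t)] (h : RelativeIterates π α β αs βs η δ Λ a b) :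
    ∃ K : ℝ, 1 ≤ K ∧ ∀ t x x', a t x ≤ K * a t x' ∧ b t x ≤ K * b t x' := by
  have hinit : ∀ c : X → ℝ, Continuous c → (∀ x, 0 < c x) → ∃ K : ℝ, ∀ x x', c x ≤ K * c x' := by
    intro c hc hpos
    obtain ⟨p, hp⟩ := hc.exists_forall_le_of_hasCompactSupport (HasCompactSupport.of_compactSpace c)
    obtain ⟨q, hq⟩ := hc.exists_forall_ge_of_hasCompactSupport (HasCompactSupport.of_compactSpace c)
    refine ⟨c q / c p, fun x x' => (hq x).trans ?_⟩
    rw [div_mul_eq_mul_div, le_div_iff₀ (hpos p)]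
    exact mul_le_mul_of_nonneg_left (hp x') (hpos q).le
  obtain ⟨K₁, h₁⟩ := hinit (a 0) (h.continuous_left 0) (h.left_pos 0)
  obtain ⟨K₂, h₂⟩ := hinit (b 0) (h.continuous_right 0) (h.right_pos 0)
  set K := max 1 (max (Λ / δ) (max K₁ K₂)) with hKdef
  have hKΛ : Λ ≤ K * δ := by
    rw [← div_le_iff₀ h.kernel_pos]
    exact (le_max_left _ _).trans (le_max_right _ _)
  have hK1 : K₁ ≤ K := (le_max_left _ _).trans ((le_max_right _ _).trans (le_max_right _ _))
  have hK2 : K₂ ≤ K := (le_max_right _ _).trans ((le_max_right _ _).trans (le_max_right _ _))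
  refine ⟨K, le_max_left _ _, fun t => ?_⟩
  induction t with
  | zero =>
    exact fun x x' => ⟨(h₁ x x').trans (mul_le_mul_of_nonneg_right hK1 (h.left_pos 0 x').le),
      (h₂ x x').trans (mul_le_mul_of_nonneg_right hK2 (h.right_pos 0 x').le)⟩
  | succ t ih =>
    exact fun x x' => ⟨h.left_succ_le_mul hKΛ (fun x x' => (ih x x').1) x x',
      h.symm.left_succ_le_mul hKΛ (fun x x' => (ih x x').2) x x'⟩

end RelativeIterates
end OnlineSinkhorn

/-! ### Bounds on the scale of the iterates. -/

namespace OnlineSinkhorn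

lemma integral_mul_add_mul_add {X : Type*} [MeasurableSpace X] {μ : Measure X} {f g h : X → ℝ}
    (hf : Integrable f μ) (hg : Integrable g μ) (hh : Integrable h μ) (c e : ℝ) :
    ∫ x, (c * f x + e * (g x + h x)) ∂μ = c * ∫ x, f x ∂μ + e * (∫ x, g x ∂μ + ∫ x, h x ∂μ) := by
  rw [← integral_add hg hh, ← integral_const_mul, ← integral_const_mul]
  exact integral_add (hf.const_mul c) ((hg.add hh).const_mul e)

namespace RelativeIterates

variable {X : Type*} [MetricSpace X] [CompactSpace X] [MeasurableSpace X] [BorelSpace X]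
  {π : X → X → ℝ} {α β : Measure X} {αs βs : ℕ → Measure X} {η : ℕ → ℝ} {δ Λ : ℝ}
  {a b : ℕ → X → ℝ}

lemma div_le_update (h : RelativeIterates π α β αs βs η δ Λ a b) {K : ℝ} {t : ℕ}
    (hK : ∀ y y', b t y ≤ K * b t y') (x₀ x : X) (μ : Measure X) [IsProbabilityMeasure μ] :
    δ / (K * b t x₀) ≤ ∫ y, π x y / b t y ∂μ :=
  le_integral_of_forall_le (h.continuous_integrand_right t x) μ fun y =>
    div_le_div₀ (h.kernel_pos.le.trans (h.le_kernel x y)) (h.le_kernel x y) (h.right_pos t y)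
      (hK y x₀)

variable [IsProbabilityMeasure β]

/-- Jensen's inequality for the inverse and the conditional laws of the optimal plan. -/
lemma inv_update_le (h : RelativeIterates π α β αs βs η δ Λ a b) (t : ℕ) (x : X) :
    (∫ y, π x y / b t y ∂β)⁻¹ ≤ ∫ y, π x y * b t y ∂β := by
  set A := ∫ y, π x y / b t y ∂β with hA
  have hbK : Continuous (b t) := h.continuous_right t
  have hApos : 0 < A := by
    have : Nonempty X := ⟨x⟩
    obtain ⟨q, hq⟩ :=
      hbK.exists_forall_ge_of_hasCompactSupport (HasCompactSupport.of_compactSpace (b t))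
    refine (div_pos h.kernel_pos (h.right_pos t q)).trans_le ?_
    refine le_integral_of_forall_le (h.continuous_integrand_right t x) β fun y => ?_
    exact div_le_div₀ (h.kernel_pos.le.trans (h.le_kernel x y)) (h.le_kernel x y)
      (h.right_pos t y) (hq y)
  have hi1 : Integrable (fun y => π x y * b t y) β :=
    ((h.continuous_kernel_right x).mul hbK).integrable_of_compactSpace β
  have hi2 : Integrable (fun y => π x y / b t y) β :=
    (h.continuous_integrand_right t x).integrable_of_compactSpace β
  have hi3 : Integrable (π x) β := (h.continuous_kernel_right x).integrable_of_compactSpace β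
  -- The tangent inequality at `A⁻¹`, that is `π / b * (b - A⁻¹) ^ 2 ≥ 0`. Integrated with `∫ π = 1`
  -- and `∫ π / b = A`, it reads `2 * A⁻¹ ≤ ∫ π * b + A⁻¹`.
  have key : ∫ y, 2 * A⁻¹ * π x y ∂β ≤ ∫ y, (π x y * b t y + A⁻¹ ^ 2 * (π x y / b t y)) ∂β := by
    refine integral_mono (hi3.const_mul _) (hi1.add (hi2.const_mul _)) fun y => ?_
    have hb := h.right_pos t y
    have : π x y * b t y + A⁻¹ ^ 2 * (π x y / b t y) - 2 * A⁻¹ * π x y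
        = π x y / b t y * (b t y - A⁻¹) ^ 2 := by field_simp; ring
    have h2 : 0 ≤ π x y / b t y * (b t y - A⁻¹) ^ 2 :=
      mul_nonneg (div_nonneg (h.kernel_pos.le.trans (h.le_kernel x y)) hb.le) (sq_nonneg _)
    change 2 * A⁻¹ * π x y ≤ π x y * b t y + A⁻¹ ^ 2 * (π x y / b t y)
    linarith
  rw [integral_const_mul, h.marginal_left, integral_add hi1 (hi2.const_mul _), integral_const_mul,
    ← hA] at key
  have : A⁻¹ ^ 2 * A = A⁻¹ := by field_simp
  linarith

variable [IsProbabilityMeasure α]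

/-- The growth of `∫ 1 / a dα`. -/
lemma integral_inv_succ_le [∀ t, IsProbabilityMeasure (βs t)]
    (h : RelativeIterates π α β αs βs η δ Λ a b) {K : ℝ} (hK1 : 1 ≤ K)
    {t : ℕ} (hK : ∀ y y', b t y ≤ K * b t y') (x₀ : X) :
    ∫ x, (a (t + 1) x)⁻¹ ∂α ≤ (1 - η t) * ∫ x, (a t x)⁻¹ ∂α + η t * ((∫ y, b t y ∂β) *
      (1 + K ^ 3 / δ ^ 2 * (b t x₀ * ∫ x, |samplingError π β (βs t) (b t) x| ∂α))) := by
  have hδ := h.kernel_pos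
  have hb0 := h.right_pos t x₀
  -- Both the sampled update and the exact one have inverse at most `K * b t x₀ / δ`; hence `κ` is a
  -- Lipschitz constant for the inverse between them.
  set κ := (K * b t x₀ / δ) ^ 2 with hκ
  have hlow : ∀ (μ : Measure X) [IsProbabilityMeasure μ] (x : X),
      δ / (K * b t x₀) ≤ ∫ y, π x y / b t y ∂μ := fun μ _ x => h.div_le_update hK x₀ x μ
  have hlow0 : 0 < δ / (K * b t x₀) := by positivity
  have hpt : ∀ x, (a (t + 1) x)⁻¹ ≤ (1 - η t) * (a t x)⁻¹ + η t * (∫ y, π x y * b t y ∂β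
      + κ * |samplingError π β (βs t) (b t) x|) := by
    intro x
    rw [h.left_succ]
    have hA1 := hlow (βs t) x
    have hA2 := hlow β x
    set A₁ := ∫ y, π x y / b t y ∂(βs t) with hA₁
    set A₂ := ∫ y, π x y / b t y ∂β with hA₂
    have hp1 := hlow0.trans_le hA1
    have hp2 := hlow0.trans_le hA2
    refine (inv_convex_combination_le (h.step_nonneg t) (h.step_le_one t) (h.left_pos t x)
      hp1).trans ?_
    refine add_le_add le_rfl (mul_le_mul_of_nonneg_left ?_ (h.step_nonneg t))
    have h1 : A₂⁻¹ ≤ ∫ y, π x y * b t y ∂β := h.inv_update_le t x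
    have h2 : A₁⁻¹ ≤ K * b t x₀ / δ := by
      rw [← inv_div]; exact inv_anti₀ hlow0 hA1
    have h3 : A₂⁻¹ ≤ K * b t x₀ / δ := by
      rw [← inv_div]; exact inv_anti₀ hlow0 hA2
    have h4 : A₁⁻¹ = A₂⁻¹ + A₁⁻¹ * A₂⁻¹ * (A₂ - A₁) := by field_simp; ring
    have h5 : A₂ - A₁ ≤ |samplingError π β (βs t) (b t) x| := by
      rw [samplingError, abs_sub_comm]; exact le_abs_self _
    have h6 : A₁⁻¹ * A₂⁻¹ ≤ κ := by
      rw [hκ, sq]; exact mul_le_mul h2 h3 (inv_pos.2 hp2).le (by positivity)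
    have h7 : A₁⁻¹ * A₂⁻¹ * (A₂ - A₁) ≤ κ * |samplingError π β (βs t) (b t) x| :=
      (mul_le_mul_of_nonneg_left h5 (by positivity)).trans
        (mul_le_mul_of_nonneg_right h6 (abs_nonneg _))
    linarith
  have hcπb : Continuous fun p : X × X => π p.1 p.2 * b t p.2 :=
    h.continuous_kernel.mul ((h.continuous_right t).comp continuous_snd)
  have hc1 : Continuous fun x => ∫ y, π x y * b t y ∂β :=
    continuous_integral_right (F := fun x y => π x y * b t y) hcπb β
  have hc2 := (h.continuous_samplingError t).abs
  have hcinv : ∀ s, Continuous fun x => (a s x)⁻¹ := fun s =>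
    (h.continuous_left s).inv₀ fun x => (h.left_pos s x).ne'
  have hi1 := hc1.integrable_of_compactSpace α
  have hi2 := (hc2.integrable_of_compactSpace α).const_mul κ
  have hi3 := ((hcinv t).integrable_of_compactSpace α).const_mul (1 - η t)
  have hint := integral_mono ((hcinv (t + 1)).integrable_of_compactSpace α)
    (hi3.add ((hi1.add hi2).const_mul (η t))) hpt
  have hswap : ∫ x, ∫ y, π x y * b t y ∂β ∂α = ∫ y, b t y ∂β := by
    rw [integral_integral_swap_of_continuous (F := fun x y => π x y * b t y) hcπb α β]
    refine integral_congr_ae (Eventually.of_forall fun y => ?_)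
    change ∫ x, π x y * b t y ∂α = b t y
    rw [integral_mul_const, h.marginal_right, one_mul]
  have heq : ∫ x, ((1 - η t) * (a t x)⁻¹ + η t * (∫ y, π x y * b t y ∂β
      + κ * |samplingError π β (βs t) (b t) x|)) ∂α = (1 - η t) * ∫ x, (a t x)⁻¹ ∂α
      + η t * (∫ y, b t y ∂β + κ * ∫ x, |samplingError π β (βs t) (b t) x| ∂α) := by
    rw [integral_mul_add_mul_add ((hcinv t).integrable_of_compactSpace α) hi1 hi2, hswap,
      integral_const_mul]
  refine hint.trans (heq.le.trans (add_le_add le_rfl (mul_le_mul_of_nonneg_left ?_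
    (h.step_nonneg t))))
  -- Of the two factors `b t x₀` in `κ`, one stays with the error and makes it scale-free; the other
  -- is traded for `K * ∫ b dβ`, so that the error acts multiplicatively.
  have hW : b t x₀ ≤ K * ∫ y, b t y ∂β := by
    rw [← integral_const_mul]
    exact le_integral_of_forall_le ((h.continuous_right t).const_mul K) β fun y => hK x₀ y
  have hs : 0 ≤ ∫ x, |samplingError π β (βs t) (b t) x| ∂α :=
    integral_nonneg fun x => abs_nonneg _
  set I := ∫ x, |samplingError π β (βs t) (b t) x| ∂α
  have : κ * I = K ^ 2 / δ ^ 2 * (b t x₀ * I) * b t x₀ := by rw [hκ]; field_simp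
  have h9 : κ * I ≤ K ^ 2 / δ ^ 2 * (b t x₀ * I) * (K * ∫ y, b t y ∂β) := by
    rw [this]; exact mul_le_mul_of_nonneg_left hW (by positivity)
  calc _ ≤ ∫ y, b t y ∂β + K ^ 2 / δ ^ 2 * (b t x₀ * I) * (K * ∫ y, b t y ∂β) := by linarith
    _ = _ := by ring

/-- The growth of `∫ b dβ`. -/
lemma integral_succ_le [∀ t, IsProbabilityMeasure (αs t)]
    (h : RelativeIterates π α β αs βs η δ Λ a b) {K : ℝ}
    {t : ℕ} (hK : ∀ x x', a t x ≤ K * a t x') (x₀ : X) :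
    ∫ y, b (t + 1) y ∂β ≤ (1 - η t) * ∫ y, b t y ∂β + η t * ((∫ x, (a t x)⁻¹ ∂α) *
      (1 + K * (a t x₀ * ∫ y, |samplingError (flip π) α (αs t) (a t) y| ∂β))) := by
  have hcinv : Continuous fun x => (a t x)⁻¹ :=
    (h.continuous_left t).inv₀ fun x => (h.left_pos t x).ne'
  have hc0 := h.symm.continuous_update t α
  have hc1 := h.symm.continuous_samplingError t
  have hsplit : ∀ y, b (t + 1) y = (1 - η t) * b t y + η t * (∫ x, π x y / a t x ∂α
      + samplingError (flip π) α (αs t) (a t) y) := by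
    intro y; rw [h.right_succ, samplingError]; simp [flip]
  have hi0 := hc0.integrable_of_compactSpace β
  have hi1 := hc1.integrable_of_compactSpace β
  have hswap : ∫ y, ∫ x, π x y / a t x ∂α ∂β = ∫ x, (a t x)⁻¹ ∂α := by
    rw [integral_integral_swap_of_continuous (F := fun y x => π x y / a t x)
      (h.symm.continuous_integrand t) β α]
    refine integral_congr_ae (Eventually.of_forall fun x => ?_)
    change ∫ y, π x y / a t x ∂β = (a t x)⁻¹
    rw [integral_div, h.marginal_left, one_div]
  have heq : ∫ y, b (t + 1) y ∂β = (1 - η t) * ∫ y, b t y ∂β + η t * (∫ x, (a t x)⁻¹ ∂α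
      + ∫ y, samplingError (flip π) α (αs t) (a t) y ∂β) := by
    rw [integral_congr_ae (Eventually.of_forall hsplit),
      ← hswap]
    exact integral_mul_add_mul_add ((h.continuous_right t).integrable_of_compactSpace β) hi0 hi1 _ _
  rw [heq]
  refine add_le_add le_rfl (mul_le_mul_of_nonneg_left ?_ (h.step_nonneg t))
  have h1 : ∫ y, samplingError (flip π) α (αs t) (a t) y ∂β
      ≤ ∫ y, |samplingError (flip π) α (αs t) (a t) y| ∂β :=
    (le_abs_self _).trans (abs_integral_le_integral_abs)
  have hs : 0 ≤ ∫ y, |samplingError (flip π) α (αs t) (a t) y| ∂β :=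
    integral_nonneg fun x => abs_nonneg _
  set I := ∫ y, |samplingError (flip π) α (αs t) (a t) y| ∂β
  -- This makes the additive error multiplicative: the factor `a t x₀` renders it scale-free and `∫
  -- 1 / a dα` is pulled out.
  have h2 : 1 ≤ K * a t x₀ * ∫ x, (a t x)⁻¹ ∂α := by
    rw [← integral_const_mul]
    refine le_integral_of_forall_le (hcinv.const_mul _) α fun x => ?_
    rw [← div_eq_mul_inv, one_le_div (h.left_pos t x)]
    exact hK x x₀
  have h3 := mul_le_mul_of_nonneg_left h2 hs
  nlinarith

variable [∀ t, IsProbabilityMeasure (αs t)] [∀ t, IsProbabilityMeasure (βs t)]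

/-- One half of the bound on the scale of the iterates. -/
lemma exists_integral_bound (h : RelativeIterates π α β αs βs η δ Λ a b) {K : ℝ} (hK1 : 1 ≤ K)
    (hK : ∀ t x x', a t x ≤ K * a t x' ∧ b t x ≤ K * b t x') (x₀ : X)
    (hs₁ : Summable fun t =>
      η t * (b t x₀ * ∫ x, |samplingError π β (βs t) (b t) x| ∂α))
    (hs₂ : Summable fun t =>
      η t * (a t x₀ * ∫ y, |samplingError (flip π) α (αs t) (a t) y| ∂β)) :
    ∃ M, ∀ t, ∫ x, (a t x)⁻¹ ∂α ≤ M ∧ ∫ y, b t y ∂β ≤ M := by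
  set s₁ := fun t => b t x₀ * ∫ x, |samplingError π β (βs t) (b t) x| ∂α with hs₁def
  set s₂ := fun t => a t x₀ * ∫ y, |samplingError (flip π) α (αs t) (a t) y| ∂β with hs₂def
  have hs₁0 : ∀ t, 0 ≤ s₁ t := fun t =>
    mul_nonneg (h.right_pos t x₀).le (integral_nonneg fun x => abs_nonneg _)
  have hs₂0 : ∀ t, 0 ≤ s₂ t := fun t =>
    mul_nonneg (h.left_pos t x₀).le (integral_nonneg fun x => abs_nonneg _)
  have hδ := h.kernel_pos
  have hY0 : ∀ t, 0 ≤ ∫ x, (a t x)⁻¹ ∂α := fun t =>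
    integral_nonneg fun x => (inv_pos.2 (h.left_pos t x)).le
  have hW0 : ∀ t, 0 ≤ ∫ y, b t y ∂β := fun t => integral_nonneg fun y => (h.right_pos t y).le
  set r := fun t => K ^ 3 / δ ^ 2 * (η t * s₁ t) + K * (η t * s₂ t) with hr
  have hr1 : ∀ t, 0 ≤ K ^ 3 / δ ^ 2 * (η t * s₁ t) := fun t =>
    mul_nonneg (by positivity) (mul_nonneg (h.step_nonneg t) (hs₁0 t))
  have hr2 : ∀ t, 0 ≤ K * (η t * s₂ t) := fun t =>
    mul_nonneg (by positivity) (mul_nonneg (h.step_nonneg t) (hs₂0 t))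
  -- Each of the two integrals is bounded by a combination of its own previous value and that of the
  -- other, so it is their maximum that satisfies a closed recursion.
  obtain ⟨M, hM⟩ := exists_bound_of_le_mul_one_add
    (M := fun t => max (∫ x, (a t x)⁻¹ ∂α) (∫ y, b t y ∂β)) (r := r)
    (fun t => (hY0 t).trans (le_max_left _ _)) (fun t => add_nonneg (hr1 t) (hr2 t))
    ((hs₁.mul_left _).add (hs₂.mul_left _)) (fun t => by
      have h1 := h.integral_inv_succ_le hK1 (fun y y' => (hK t y y').2) x₀
      have h2 := h.integral_succ_le (fun y y' => (hK t y y').1) x₀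
      change _ ≤ (1 - η t) * _ + η t * (_ * (1 + K ^ 3 / δ ^ 2 * s₁ t)) at h1
      change _ ≤ (1 - η t) * _ + η t * (_ * (1 + K * s₂ t)) at h2
      set Y := ∫ x, (a t x)⁻¹ ∂α
      set W := ∫ y, b t y ∂β
      have hYm : Y ≤ max Y W := le_max_left _ _
      have hWm : W ≤ max Y W := le_max_right _ _
      have hm0 : 0 ≤ max Y W := (hY0 t).trans hYm
      have h1η := sub_nonneg.2 (h.step_le_one t)
      refine max_le (h1.trans ?_) (h2.trans ?_)
      · have e1 := mul_le_mul_of_nonneg_left hYm h1η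
        have e2 := mul_le_mul_of_nonneg_left hWm (h.step_nonneg t)
        have e3 := mul_le_mul_of_nonneg_right hWm (hr1 t)
        have e4 := mul_nonneg hm0 (hr2 t)
        simp only [hr]
        linarith
      · have e1 := mul_le_mul_of_nonneg_left hWm h1η
        have e2 := mul_le_mul_of_nonneg_left hYm (h.step_nonneg t)
        have e3 := mul_le_mul_of_nonneg_right hYm (hr2 t)
        have e4 := mul_nonneg hm0 (hr1 t)
        simp only [hr]
        linarith)
  exact ⟨M, fun t => ⟨(le_max_left _ _).trans (hM t), (le_max_right _ _).trans (hM t)⟩⟩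

/-- With bounded oscillation a positive function is controlled pointwise by its mean.
`exists_integral_bound` supplies the means of `1 / a` and `b`, its mirror image those of `1 / b` and
`a`. -/
lemma exists_uniform_bounds (h : RelativeIterates π α β αs βs η δ Λ a b) {K : ℝ} (hK1 : 1 ≤ K)
    (hK : ∀ t x x', a t x ≤ K * a t x' ∧ b t x ≤ K * b t x') (x₀ : X)
    (hs₁ : Summable fun t =>
      η t * (b t x₀ * ∫ x, |samplingError π β (βs t) (b t) x| ∂α))
    (hs₂ : Summable fun t =>
      η t * (a t x₀ * ∫ y, |samplingError (flip π) α (αs t) (a t) y| ∂β)) :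
    ∃ M, 0 < M ∧ ∀ t x, a t x ≤ M ∧ (a t x)⁻¹ ≤ M ∧ b t x ≤ M ∧ (b t x)⁻¹ ≤ M := by
  obtain ⟨M₁, hM₁⟩ := h.exists_integral_bound hK1 hK x₀ hs₁ hs₂
  obtain ⟨M₂, hM₂⟩ := h.symm.exists_integral_bound hK1 (fun t x x' => (hK t x x').symm) x₀
    hs₂ hs₁
  have hK0 : 0 < K := by linarith
  have hup : ∀ (c : X → ℝ) (μ : Measure X) [IsProbabilityMeasure μ], Continuous c →
      (∀ x x', c x ≤ K * c x') → ∀ x, c x ≤ K * ∫ x, c x ∂μ := by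
    intro c μ _ hc hcK x
    rw [← integral_const_mul]
    exact le_integral_of_forall_le (hc.const_mul K) μ fun x' => hcK x x'
  have hinv : ∀ c : X → ℝ, (∀ x, 0 < c x) → (∀ x x', c x ≤ K * c x') →
      ∀ x x', (c x)⁻¹ ≤ K * (c x')⁻¹ := by
    intro c hc hcK x x'
    rw [← div_eq_mul_inv, inv_le_comm₀ (hc x) (div_pos hK0 (hc x')), inv_div,
      div_le_iff₀ hK0, mul_comm]
    exact hcK x' x
  refine ⟨K * max 1 (max M₁ M₂), by positivity, fun t x => ?_⟩
  have m1 : K * M₁ ≤ K * max 1 (max M₁ M₂) :=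
    mul_le_mul_of_nonneg_left ((le_max_left _ _).trans (le_max_right _ _)) hK0.le
  have m2 : K * M₂ ≤ K * max 1 (max M₁ M₂) :=
    mul_le_mul_of_nonneg_left ((le_max_right _ _).trans (le_max_right _ _)) hK0.le
  have ca := h.continuous_left t
  have cb := h.continuous_right t
  have ca' := ca.inv₀ fun x => (h.left_pos t x).ne'
  have cb' := cb.inv₀ fun x => (h.right_pos t x).ne'
  have ka := fun x x' => (hK t x x').1
  have kb := fun x x' => (hK t x x').2
  refine ⟨(hup _ α ca ka x).trans ?_, (hup _ α ca' (hinv _ (h.left_pos t) ka) x).trans ?_,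
    (hup _ β cb kb x).trans ?_, (hup _ β cb' (hinv _ (h.right_pos t) kb) x).trans ?_⟩
  · exact (mul_le_mul_of_nonneg_left (hM₂ t).2 hK0.le).trans m2
  · exact (mul_le_mul_of_nonneg_left (hM₁ t).1 hK0.le).trans m1
  · exact (mul_le_mul_of_nonneg_left (hM₁ t).2 hK0.le).trans m1
  · exact (mul_le_mul_of_nonneg_left (hM₂ t).1 hK0.le).trans m2

end RelativeIterates
end OnlineSinkhorn

/-! ### Contraction of the oscillation. -/

namespace OnlineSinkhorn
namespace RelativeIterates

variable {X : Type*} [MetricSpace X] [CompactSpace X] [MeasurableSpace X] [BorelSpace X]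
  {π : X → X → ℝ} {α β : Measure X} {αs βs : ℕ → Measure X} {η : ℕ → ℝ} {δ Λ : ℝ}
  {a b : ℕ → X → ℝ} [IsProbabilityMeasure β]

/-- Doeblin's contraction: the kernel `π` averages out a part `δ` of the oscillation. -/
lemma update_sub_update_le (h : RelativeIterates π α β αs βs η δ Λ a b) {t : ℕ} {d : ℝ}
    (hb : ∀ y y', b t y ≤ (1 + d) * b t y') (y₀ : X) (hy₀ : ∀ y, b t y ≤ b t y₀) (x x' : X) :
    ∫ y, π x y / b t y ∂β - ∫ y, π x' y / b t y ∂β ≤ d * (1 - δ) * (b t y₀)⁻¹ := by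
  have hi := fun x => (h.continuous_integrand_right t x).integrable_of_compactSpace β
  have hk := fun x => (h.continuous_kernel_right x).integrable_of_compactSpace β
  set n := (b t y₀)⁻¹ with hn
  -- Here `1 / b` lies between `n` and `(1 + d) * n`. The common part `δ / b` of both terms cancels;
  -- the upper bound is used against `π x y - δ` and the lower one against `π x' y - δ`.
  have hpt : ∀ y, π x y / b t y - π x' y / b t y ≤
      d * n * (π x y - δ) + n * (π x y - π x' y) := by
    intro y
    have h0 := h.right_pos t y
    have h1 : n ≤ (b t y)⁻¹ := inv_anti₀ h0 (hy₀ y)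
    have h2 : (b t y)⁻¹ ≤ (1 + d) * n := by
      rw [hn, ← div_eq_mul_inv, inv_eq_one_div, div_le_div_iff₀ h0 (h.right_pos t y₀), one_mul]
      exact hb y₀ y
    have h3 : 0 ≤ (π x' y - δ) * ((b t y)⁻¹ - n) :=
      mul_nonneg (sub_nonneg.2 (h.le_kernel x' y)) (sub_nonneg.2 h1)
    have h4 : 0 ≤ (π x y - δ) * ((1 + d) * n - (b t y)⁻¹) :=
      mul_nonneg (sub_nonneg.2 (h.le_kernel x y)) (sub_nonneg.2 h2)
    rw [div_eq_mul_inv, div_eq_mul_inv]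
    linarith
  rw [← integral_sub (hi x) (hi x')]
  refine (integral_mono ((hi x).sub (hi x')) ((((hk x).sub (integrable_const δ)).const_mul
    (d * n)).add (((hk x).sub (hk x')).const_mul n)) hpt).trans (le_of_eq ?_)
  have h5 := integral_mul_add_mul_add (μ := β) (f := fun y => π x y - δ) (g := π x)
    (h := fun y => -π x' y) ((hk x).sub (integrable_const δ)) (hk x) (hk x').neg (d * n) n
  simp only [← sub_eq_add_neg] at h5
  refine h5.trans ?_
  rw [integral_sub (hk x) (integrable_const δ), integral_neg, h.marginal_left, h.marginal_left]
  simp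
  ring

/-- One half of the contraction step. -/
lemma left_succ_le_contraction (h : RelativeIterates π α β αs βs η δ Λ a b) {M : ℝ} {t : ℕ}
    (hM : ∀ x, a t x ≤ M ∧ b t x ≤ M ∧ (b t x)⁻¹ ≤ M) (hM' : ∀ x, (a (t + 1) x)⁻¹ ≤ M) {d z : ℝ}
    (hd : 0 ≤ d) (ha : ∀ x x', a t x ≤ (1 + d) * a t x') (hb : ∀ y y', b t y ≤ (1 + d) * b t y')
    (hz : ∀ x, |samplingError π β (βs t) (b t) x| ≤ z) (x x' : X) :
    a (t + 1) x ≤ (1 + ((1 - δ / M ^ 2 * η t) * d + η t * (z * ((d + 2) * M)))) * a (t + 1) x' := by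
  have : Nonempty X := ⟨x⟩
  obtain ⟨y₀, hy₀⟩ := (h.continuous_right t).exists_forall_ge_of_hasCompactSupport
    (HasCompactSupport.of_compactSpace (b t))
  have h0 := h.right_pos t y₀
  have hM0 : 0 < M := (h.left_pos t x).trans_le (hM x).1
  have hη := h.step_nonneg t
  have hη1 := sub_nonneg.2 (h.step_le_one t)
  have hδ := h.kernel_pos
  set n := (b t y₀)⁻¹ with hn
  have hn0 : 0 < n := inv_pos.2 h0
  have hnM : n ≤ M := (hM y₀).2.2
  have hMn : 1 ≤ M * n := by
    rw [hn, ← div_eq_mul_inv, one_le_div h0]; exact (hM y₀).2.1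
  have hpos := h.left_pos (t + 1) x'
  have hlow : 1 ≤ M * a (t + 1) x' := by
    have h2 := hM' x'
    rwa [inv_le_iff_one_le_mul₀ hpos] at h2
  have hsplit : ∀ x, a (t + 1) x = (1 - η t) * a t x + η t * (∫ y, π x y / b t y ∂β
      + samplingError π β (βs t) (b t) x) := by
    intro x; rw [h.left_succ, samplingError]; ring
  have hcontr := h.update_sub_update_le hb y₀ hy₀ x x'
  have hnlow : n ≤ ∫ y, π x' y / b t y ∂β := by
    have : ∫ y, π x' y * n ∂β ≤ ∫ y, π x' y / b t y ∂β := by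
      refine integral_mono (((h.continuous_kernel_right x').mul_const n).integrable_of_compactSpace β)
        ((h.continuous_integrand_right t x').integrable_of_compactSpace β) fun y => ?_
      exact mul_le_mul_of_nonneg_left (inv_anti₀ (h.right_pos t y) (hy₀ y))
        (hδ.le.trans (h.le_kernel x' y))
    rwa [integral_mul_const, h.marginal_left, one_mul] at this
  have hz1 := abs_le.1 (hz x)
  have hz2 := abs_le.1 (hz x')
  have hz0 : 0 ≤ z := (abs_nonneg _).trans (hz x)
  rw [← hn] at hcontr
  -- `E` is a lower bound for the update without sampling error
  set E := (1 - η t) * a t x' + η t * n with hE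
  have hE0 : 0 ≤ E := add_nonneg (mul_nonneg hη1 (h.left_pos t x').le) (mul_nonneg hη hn0.le)
  have hEM : E ≤ M := by
    have := mul_le_mul_of_nonneg_left (hM x').1 hη1
    have := mul_le_mul_of_nonneg_left hnM hη
    linarith
  have hElow : E ≤ a (t + 1) x' + η t * z := by
    rw [hsplit x']
    have := mul_le_mul_of_nonneg_left hnlow hη
    have := mul_le_mul_of_nonneg_left hz2.1 hη
    linarith
  have hdiff : a (t + 1) x - a (t + 1) x' ≤ d * E - η t * (δ * d * n) + 2 * (η t * z) := by
    rw [hsplit x, hsplit x']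
    have e1 := mul_le_mul_of_nonneg_left (ha x x') hη1
    have e2 := mul_le_mul_of_nonneg_left hcontr hη
    have e3 := mul_le_mul_of_nonneg_left hz1.2 hη
    have e4 := mul_le_mul_of_nonneg_left hz2.1 hη
    rw [hE]
    linarith
  -- Since `E ≤ M` and `1 ≤ M * n`, the absolute gain `δ * d * n` is a gain relative to `E` at the
  -- rate `δ / M ^ 2`.
  have hgain : δ / M ^ 2 * η t * d * E ≤ η t * (δ * d * n) := by
    have e1 : E ≤ M ^ 2 * n := hEM.trans (by nlinarith)
    have e2 : 0 ≤ δ / M ^ 2 * η t * d := by positivity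
    calc _ ≤ δ / M ^ 2 * η t * d * (M ^ 2 * n) := mul_le_mul_of_nonneg_left e1 e2
      _ = _ := by field_simp
  have hc0 : 0 ≤ δ / M ^ 2 * η t := by positivity
  have hM1 : 1 ≤ M ^ 2 := by nlinarith
  have hδ1 : δ ≤ 1 := by
    have := le_integral_of_forall_le (h.continuous_kernel_right x) β (h.le_kernel x)
    rwa [h.marginal_left] at this
  have hc1 : δ / M ^ 2 * η t ≤ 1 :=
    mul_le_one₀ ((div_le_one (by positivity)).2 (hδ1.trans hM1)) hη (h.step_le_one t)
  have hstep : d * (1 - δ / M ^ 2 * η t) * E ≤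
      d * (1 - δ / M ^ 2 * η t) * (a (t + 1) x' + η t * z) :=
    mul_le_mul_of_nonneg_left hElow (mul_nonneg hd (by linarith))
  have hnoise : d * (1 - δ / M ^ 2 * η t) * (η t * z) ≤ d * (η t * z) := by
    have := mul_nonneg (mul_nonneg hd hc0) (mul_nonneg hη hz0)
    linarith
  -- The noise is made relative to `a (t + 1) x'`. Two of the `d + 2` errors come from the
  -- difference at `x` and `x'`, the other `d` from replacing `E` by `a (t + 1) x'`.
  have hlast : (d + 2) * (η t * z) ≤ (d + 2) * (η t * z) * (M * a (t + 1) x') :=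
    le_mul_of_one_le_right (by positivity) hlow
  linarith

variable [∀ t, IsProbabilityMeasure (βs t)]

/-- The sampling errors are equicontinuous. -/
lemma exists_finite_net (h : RelativeIterates π α β αs βs η δ Λ a b) {M : ℝ} (hM0 : 0 < M)
    (hM : ∀ t x, (b t x)⁻¹ ≤ M) {S : Set X} (hS : Dense S) {ε : ℝ} (hε : 0 < ε) :
    ∃ F : Finset X, (F : Set X) ⊆ S ∧ ∀ t x, |samplingError π β (βs t) (b t) x| ≤
      ∑ q ∈ F, |samplingError π β (βs t) (b t) q| + ε := by
  -- The modulus of continuity of `x ↦ ∫ π x y / b t y` depends only on `π` and on the bound `M` for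
  -- `1 / b`, so one net serves all times and both measures.
  have huc := CompactSpace.uniformContinuous_of_continuous h.continuous_kernel
  obtain ⟨r, hr, hπ⟩ := Metric.uniformContinuous_iff.1 huc (ε / (2 * M)) (by positivity)
  obtain ⟨F, hFS, hFfin, hF⟩ := isCompact_univ.elim_finite_subcover_image (b := S)
    (c := fun q => Metric.ball q r) (fun q _ => Metric.isOpen_ball) (fun x _ => by
      obtain ⟨q, hq, hxq⟩ := hS.exists_dist_lt x hr
      exact Set.mem_biUnion hq hxq)
  refine ⟨hFfin.toFinset, by simpa using hFS, fun t x => ?_⟩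
  obtain ⟨q, hqF, hxq⟩ := Set.mem_iUnion₂.1 (hF (Set.mem_univ x))
  have hker : ∀ y, |π x y - π q y| ≤ ε / (2 * M) := by
    intro y
    have := @hπ (x, y) (q, y) (by
      rw [Prod.dist_eq, dist_self]; exact max_lt hxq hr)
    rw [Real.dist_eq] at this
    exact this.le
  have hint : ∀ (μ : Measure X) [IsProbabilityMeasure μ],
      |∫ y, π x y / b t y ∂μ - ∫ y, π q y / b t y ∂μ| ≤ ε / 2 := by
    intro μ _
    have hi := fun x => (h.continuous_integrand_right t x).integrable_of_compactSpace μ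
    rw [← integral_sub (hi x) (hi q)]
    refine abs_integral_le_integral_abs.trans (integral_le_of_forall_le
      ((h.continuous_integrand_right t x).sub (h.continuous_integrand_right t q)).abs μ fun y => ?_)
    change |π x y / b t y - π q y / b t y| ≤ ε / 2
    rw [← sub_div, abs_div, abs_of_pos (h.right_pos t y), div_eq_mul_inv]
    calc _ ≤ ε / (2 * M) * M :=
          mul_le_mul (hker y) (hM t y) (inv_pos.2 (h.right_pos t y)).le (by positivity)
      _ = ε / 2 := by field_simp
  have h1 := hint (βs t)
  have h2 := hint β
  have h3 : |samplingError π β (βs t) (b t) x| ≤ |samplingError π β (βs t) (b t) q| + ε := by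
    have e : samplingError π β (βs t) (b t) x = samplingError π β (βs t) (b t) q
        + ((∫ y, π x y / b t y ∂(βs t) - ∫ y, π q y / b t y ∂(βs t))
          - (∫ y, π x y / b t y ∂β - ∫ y, π q y / b t y ∂β)) := by
      simp only [samplingError]; ring
    rw [e]
    refine (abs_add_le _ _).trans (add_le_add le_rfl ((abs_sub _ _).trans (by linarith)))
  -- The net point `q` depends on `x`; summing over the whole net removes this dependence and keeps
  -- summability in `t`.
  refine h3.trans (add_le_add ?_ le_rfl)
  exact Finset.single_le_sum (f := fun q => |samplingError π β (βs t) (b t) q|)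
    (fun _ _ => abs_nonneg _) (hFfin.mem_toFinset.2 hqF)

variable [IsProbabilityMeasure α] [∀ t, IsProbabilityMeasure (αs t)]

/-- The iterates become proportional to the optimal potentials, if the sampling errors are summable
against the step sizes, on average and at the points of a dense set. -/
theorem eventually_le_mul (h : RelativeIterates π α β αs βs η δ Λ a b) (x₀ : X)
    (hη : Tendsto (fun T => ∑ t ∈ Finset.range T, η t) atTop atTop) {S : Set X} (hS : Dense S)
    (hα : Summable fun t => η t * (b t x₀ * ∫ x, |samplingError π β (βs t) (b t) x| ∂α))
    (hβ : Summable fun t => η t * (a t x₀ * ∫ y, |samplingError (flip π) α (αs t) (a t) y| ∂β))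
    (hαS : ∀ q ∈ S, Summable fun t => η t * (b t x₀ * |samplingError π β (βs t) (b t) q|))
    (hβS : ∀ q ∈ S, Summable fun t => η t * (a t x₀ * |samplingError (flip π) α (αs t) (a t) q|))
    {ε : ℝ} (hε : 0 < ε) :
    ∀ᶠ t in atTop, ∀ x x', a t x ≤ (1 + ε) * a t x' ∧ b t x ≤ (1 + ε) * b t x' := by
  have : Nonempty X := ⟨x₀⟩
  obtain ⟨K, hK1, hK⟩ := h.exists_oscillation_bound
  obtain ⟨M, hM0, hM⟩ := h.exists_uniform_bounds hK1 hK x₀ hα hβ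
  have hδ := h.kernel_pos
  set c := δ / M ^ 2 with hc
  have hc0 : 0 < c := by positivity
  set C := (K + 1) * M with hC
  have hC0 : 0 < C := by positivity
  -- Chosen so that the limiting level `2 * (ε' * C / c)` equals `ε / 2`.
  set ε' := ε * c / (2 * (2 * C)) with hε'
  have hε'0 : 0 < ε' := by positivity
  obtain ⟨F, hFS, hF⟩ := h.exists_finite_net hM0 (fun t x => (hM t x).2.2.2) hS hε'0
  obtain ⟨G, hGS, hG⟩ := h.symm.exists_finite_net hM0 (fun t x => (hM t x).2.1) hS hε'0
  set s := fun t => ∑ q ∈ F, |samplingError π β (βs t) (b t) q|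
    + ∑ q ∈ G, |samplingError (flip π) α (αs t) (a t) q| with hs
  have hs0 : ∀ t, 0 ≤ s t := fun t => add_nonneg (Finset.sum_nonneg fun _ _ => abs_nonneg _)
    (Finset.sum_nonneg fun _ _ => abs_nonneg _)
  -- Now that the scale is bounded, the weights `b t x₀` and `a t x₀` can be dropped.
  have hcomp : ∀ e p : ℕ → ℝ, (∀ t, 0 < p t) → (∀ t, (p t)⁻¹ ≤ M) →
      Summable (fun t => η t * (p t * |e t|)) → Summable fun t => η t * |e t| := by
    intro e p hp hpM hsum
    refine Summable.of_nonneg_of_le (fun t => mul_nonneg (h.step_nonneg t) (abs_nonneg _))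
      (fun t => ?_) (hsum.mul_left M)
    have h1 : 1 ≤ M * p t := (inv_le_iff_one_le_mul₀ (hp t)).1 (hpM t)
    have := mul_le_mul_of_nonneg_right h1 (mul_nonneg (h.step_nonneg t) (abs_nonneg (e t)))
    linarith
  have hsum : Summable fun t => η t * s t := by
    have e : (fun t => η t * s t) = fun t =>
        ∑ q ∈ F, η t * |samplingError π β (βs t) (b t) q|
        + ∑ q ∈ G, η t * |samplingError (flip π) α (αs t) (a t) q| := by
      funext t; simp only [hs, mul_add, Finset.mul_sum]
    rw [e]
    refine (summable_sum fun q hq => ?_).add (summable_sum fun q hq => ?_)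
    · exact hcomp _ (fun t => b t x₀) (fun t => h.right_pos t x₀) (fun t => (hM t x₀).2.2.2)
        (hαS q (hFS hq))
    · exact hcomp _ (fun t => a t x₀) (fun t => h.left_pos t x₀) (fun t => (hM t x₀).2.1)
        (hβS q (hGS hq))
  have hz1 : ∀ t x, |samplingError π β (βs t) (b t) x| ≤ s t + ε' := fun t x =>
    (hF t x).trans (by
      have : 0 ≤ ∑ q ∈ G, |samplingError (flip π) α (αs t) (a t) q| :=
        Finset.sum_nonneg fun _ _ => abs_nonneg _
      simp only [hs]; linarith)
  have hz2 : ∀ t x, |samplingError (flip π) α (αs t) (a t) x| ≤ s t + ε' := fun t x =>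
    (hG t x).trans (by
      have : 0 ≤ ∑ q ∈ F, |samplingError π β (βs t) (b t) q| :=
        Finset.sum_nonneg fun _ _ => abs_nonneg _
      simp only [hs]; linarith)
  have hδ1 : δ ≤ 1 := by
    have := le_integral_of_forall_le (h.continuous_kernel_right x₀) β (h.le_kernel x₀)
    rwa [h.marginal_left] at this
  have hM1 : 1 ≤ M := by
    have h1 := hM 0 x₀
    have h2 : 1 ≤ M * a 0 x₀ := (inv_le_iff_one_le_mul₀ (h.left_pos 0 x₀)).1 h1.2.1
    nlinarith
  have hcη : ∀ t, c * η t ≤ 1 := fun t =>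
    mul_le_one₀ ((div_le_one (by positivity)).2 (hδ1.trans (one_le_pow₀ hM1)))
      (h.step_nonneg t) (h.step_le_one t)
  -- A common oscillation bound for `a` and `b`. The cap `K - 1` is the a priori bound; it keeps the
  -- noise coefficient `(D t + 2) * M` below `C`.
  let D : ℕ → ℝ := fun t => Nat.rec (motive := fun _ => ℝ) (K - 1) (fun t d =>
    min (K - 1) ((1 - c * η t) * d + η t * ((s t + ε') * ((d + 2) * M)))) t
  have hDsucc : ∀ t, D (t + 1) =
      min (K - 1) ((1 - c * η t) * D t + η t * ((s t + ε') * ((D t + 2) * M))) := fun t => rfl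
  have hD : ∀ t, 0 ≤ D t ∧ D t ≤ K - 1 := by
    intro t
    induction t with
    | zero => exact ⟨sub_nonneg.2 hK1, le_rfl⟩
    | succ t ih =>
      rw [hDsucc]
      refine ⟨le_min (sub_nonneg.2 hK1) (add_nonneg (mul_nonneg (sub_nonneg.2 (hcη t)) ih.1)
        (mul_nonneg (h.step_nonneg t) (mul_nonneg (by linarith [hs0 t])
          (mul_nonneg (by linarith [ih.1]) hM0.le)))), min_le_left _ _⟩
  have hosc : ∀ t x x', a t x ≤ (1 + D t) * a t x' ∧ b t x ≤ (1 + D t) * b t x' := by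
    intro t
    induction t with
    | zero =>
      intro x x'
      have e : 1 + D 0 = K := by change 1 + (K - 1) = K; ring
      rw [e]; exact hK 0 x x'
    | succ t ih =>
      intro x x'
      rw [hDsucc]
      rcases min_choice (K - 1) ((1 - c * η t) * D t + η t * ((s t + ε') * ((D t + 2) * M)))
        with e | e <;> rw [e]
      · rw [add_sub_cancel]; exact hK (t + 1) x x'
      · exact ⟨h.left_succ_le_contraction
            (fun x => ⟨(hM t x).1, (hM t x).2.2.1, (hM t x).2.2.2⟩) (fun x => (hM (t + 1) x).2.1)
            (hD t).1 (fun x x' => (ih x x').1) (fun x x' => (ih x x').2) (hz1 t) x x',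
          h.symm.left_succ_le_contraction
            (fun x => ⟨(hM t x).2.2.1, (hM t x).1, (hM t x).2.1⟩) (fun x => (hM (t + 1) x).2.2.2)
            (hD t).1 (fun x x' => (ih x x').2) (fun x x' => (ih x x').1) (hz2 t) x x'⟩
  have hev := eventually_le_of_contraction (d := D) (s := fun t => C * (η t * s t)) hc0
    (mul_pos hε'0 hC0) h.step_nonneg hcη
    (fun t => mul_nonneg hC0.le (mul_nonneg (h.step_nonneg t) (hs0 t))) (hsum.mul_left C) hη
    (fun t => by
      rw [hDsucc]
      refine (min_le_right _ _).trans ?_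
      have h1 : (D t + 2) * M ≤ C :=
        mul_le_mul_of_nonneg_right (by linarith [(hD t).2]) hM0.le
      have h2 : 0 ≤ η t * (s t + ε') := mul_nonneg (h.step_nonneg t) (by linarith [hs0 t])
      have := mul_le_mul_of_nonneg_left h1 h2
      linarith)
  filter_upwards [hev] with t ht x x'
  have hDε : D t ≤ ε := by
    refine ht.trans (le_of_lt ?_)
    have : 2 * (ε' * C / c) = ε / 2 := by rw [hε']; field_simp
    rw [this]; linarith
  have := hosc t x x'
  exact ⟨this.1.trans (mul_le_mul_of_nonneg_right (by linarith) (h.left_pos t x').le),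
    this.2.trans (mul_le_mul_of_nonneg_right (by linarith) (h.right_pos t x').le)⟩

end RelativeIterates
end OnlineSinkhorn

/-! ### Euler equations for the optimal potentials. -/

namespace OnlineSinkhorn

lemma continuous_exp_sub_cost {X : Type*} [TopologicalSpace X] {C : X → X → ℝ} {g : X → ℝ}
    (hC : Continuous fun p : X × X => C p.1 p.2) (hg : Continuous g) :
    Continuous fun p : X × X => Real.exp (g p.2 - C p.1 p.2) := by
  fun_prop

section Optimality

variable {X : Type*} [MetricSpace X] [CompactSpace X] [MeasurableSpace X] [BorelSpace X]
  {C : X → X → ℝ} {α β : Measure X} [IsProbabilityMeasure α] [IsProbabilityMeasure β]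
  {f g : X → ℝ}

lemma dualObjective_flip (C : X → X → ℝ) (α β : Measure X) [IsProbabilityMeasure α]
    [IsProbabilityMeasure β] (f g : X → ℝ) :
    dualObjective (flip C) β α g f = dualObjective C α β f g := by
  have h := integral_prod_swap (μ := α) (ν := β)
    fun p : X × X => Real.exp (f p.1 + g p.2 - C p.1 p.2)
  simp only [dualObjective, ← h, flip, Prod.fst_swap, Prod.snd_swap]
  simp only [add_comm (g _) (f _)]
  ring

lemma IsOptimalPotentials.symm (h : IsOptimalPotentials C α β f g) :
    IsOptimalPotentials (flip C) β α g f where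
  continuous_left := h.continuous_right
  continuous_right := h.continuous_left
  isMax f' g' hf' hg' := by
    rw [dualObjective_flip, dualObjective_flip]; exact h.isMax g' f' hg' hf'
  left_off_support := h.right_off_support
  right_off_support := h.left_off_support

lemma integral_exp_sub_cost_pos (hC : Continuous fun p : X × X => C p.1 p.2) (hg : Continuous g)
    (x : X) (μ : Measure X) [IsProbabilityMeasure μ] :
    0 < ∫ y, Real.exp (g y - C x y) ∂μ :=
  integral_exp_pos (Continuous.integrable_of_compactSpace
    ((continuous_exp_sub_cost hC hg).comp (Continuous.prodMk_right x)) μ)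

lemma dualObjective_eq (hC : Continuous fun p : X × X => C p.1 p.2) (hf : Continuous f)
    (hg : Continuous g) : dualObjective C α β f g = (∫ x, f x ∂α) + (∫ y, g y ∂β)
      - (∫ x, Real.exp (f x) * ∫ y, Real.exp (g y - C x y) ∂β ∂α) + 1 := by
  have hc : Continuous fun p : X × X => Real.exp (f p.1 + g p.2 - C p.1 p.2) := by fun_prop
  rw [dualObjective, integral_prod _ (hc.integrable_of_compactSpace (α.prod β))]
  congr 3
  funext x
  rw [← integral_const_mul]
  congr 1
  funext y
  rw [← Real.exp_add]
  ring_nf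

/-- The Euler equation of the dual problem, at every point. -/
lemma IsOptimalPotentials.exp_neg_left (h : IsOptimalPotentials C α β f g)
    (hC : Continuous fun p : X × X => C p.1 p.2) (x : X) :
    Real.exp (-f x) = ∫ y, Real.exp (g y - C x y) ∂β := by
  have hf := h.continuous_left
  have hg := h.continuous_right
  by_cases hx : x ∈ α.support
  swap
  · rw [h.left_off_support x hx, softCTransform, neg_neg,
      Real.exp_log (integral_exp_sub_cost_pos hC hg x β)]
  set E : X → ℝ := fun x => Real.exp (f x) * ∫ y, Real.exp (g y - C x y) ∂β with hE
  have hEc : Continuous E := (Real.continuous_exp.comp hf).mul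
    (continuous_integral_right (F := fun x y => Real.exp (g y - C x y))
      (continuous_exp_sub_cost hC hg) β)
  -- The gradient of the dual objective in `f` with respect to `L²(α)`, used as the direction of
  -- variation.
  set r : X → ℝ := fun x => 1 - E x with hr
  have hrc : Continuous r := continuous_const.sub hEc
  obtain ⟨R, hR⟩ : ∃ R, ∀ x, |r x| ≤ R := by
    obtain ⟨R, hR⟩ := isCompact_univ.exists_bound_of_continuousOn hrc.continuousOn
    exact ⟨R, fun x => hR x (Set.mem_univ x)⟩
  have hR0 : 0 ≤ R := (abs_nonneg _).trans (hR x)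
  have hE0 : ∀ x, 0 ≤ E x := fun x =>
    mul_nonneg (Real.exp_pos _).le (integral_exp_sub_cost_pos hC hg x β).le
  have hi : ∀ {F : X → ℝ}, Continuous F → Integrable F α := fun hF =>
    hF.integrable_of_compactSpace α
  -- Maximality against `f + s * r`: the first-order gain is `s * ∫ r ^ 2`, and `exp u ≤ 1 + u + u ^
  -- 2` for `|u| ≤ 1` bounds the second-order loss. Letting `s` tend to zero gives `∫ r ^ 2 = 0`.
  have key : ∀ s, 0 < s → s * R ≤ 1 → ∫ x, r x ^ 2 ∂α ≤ s * ∫ x, r x ^ 2 * E x ∂α := by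
    intro s hs hsR
    have hfs : Continuous fun x => f x + s * r x := hf.add (hrc.const_mul s)
    have hopt := h.isMax (fun x => f x + s * r x) g hfs hg
    rw [dualObjective_eq hC hfs hg, dualObjective_eq hC hf hg,
      integral_add (hi hf) (hi (hrc.const_mul s)), integral_const_mul] at hopt
    have hcmp : ∫ x, Real.exp (f x + s * r x) * ∫ y, Real.exp (g y - C x y) ∂β ∂α
        ≤ ∫ x, (1 * E x + s * (r x * E x + s * (r x ^ 2 * E x))) ∂α := by
      refine integral_mono (hi ?_) (hi (by fun_prop)) fun x => ?_
      · exact (Real.continuous_exp.comp (hf.add (hrc.const_mul s))).mul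
          (continuous_integral_right (F := fun x y => Real.exp (g y - C x y))
            (continuous_exp_sub_cost hC hg) β)
      · have h1 : |s * r x| ≤ 1 := by
          rw [abs_mul, abs_of_pos hs]
          exact (mul_le_mul_of_nonneg_left (hR x) hs.le).trans hsR
        have h2 := (abs_le.1 (Real.abs_exp_sub_one_sub_id_le h1)).2
        have h3 : Real.exp (f x + s * r x) * ∫ y, Real.exp (g y - C x y) ∂β
            = Real.exp (s * r x) * E x := by rw [hE, Real.exp_add]; ring
        have h4 := mul_le_mul_of_nonneg_right h2 (hE0 x)
        change Real.exp (f x + s * r x) * ∫ y, Real.exp (g y - C x y) ∂β ≤ _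
        rw [h3]
        linarith
    rw [integral_mul_add_mul_add (g := fun x => r x * E x) (h := fun x => s * (r x ^ 2 * E x))
      (hi hEc) (hi (hrc.mul hEc)) (hi (((hrc.pow 2).mul hEc).const_mul s)),
      integral_const_mul] at hcmp
    have hsq : ∫ x, r x ^ 2 ∂α = ∫ x, r x ∂α - ∫ x, r x * E x ∂α := by
      rw [← integral_sub (g := fun x => r x * E x) (hi hrc) (hi (hrc.mul hEc))]
      congr 1
      funext x
      simp only [hr]; ring
    rw [hsq]
    have : s * (∫ x, r x ∂α - ∫ x, r x * E x ∂α) ≤ s * (s * ∫ x, r x ^ 2 * E x ∂α) := by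
      linarith
    exact le_of_mul_le_mul_left this hs
  have hzero : ∫ x, r x ^ 2 ∂α ≤ 0 := by
    set Q := ∫ x, r x ^ 2 * E x ∂α
    have hQ : 0 ≤ Q := integral_nonneg fun x => mul_nonneg (sq_nonneg _) (hE0 x)
    refine le_of_forall_pos_le_add fun ε hε => ?_
    set s := min (R + 1)⁻¹ (ε / (Q + 1)) with hs
    have hs0 : 0 < s := lt_min (by positivity) (by positivity)
    have h1 : s * R ≤ 1 := by
      calc s * R ≤ (R + 1)⁻¹ * (R + 1) :=
            mul_le_mul (min_le_left _ _) (by linarith) hR0 (by positivity)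
        _ = 1 := inv_mul_cancel₀ (by positivity)
    have h2 : s * Q ≤ ε := by
      calc s * Q ≤ ε / (Q + 1) * (Q + 1) :=
            mul_le_mul (min_le_right _ _) (by linarith) hQ (by positivity)
        _ = ε := div_mul_cancel₀ _ (by positivity)
    linarith [key s hs0 h1]
  have hae : (fun x => r x ^ 2) =ᵐ[α] 0 := by
    rw [← integral_eq_zero_iff_of_nonneg (fun x => sq_nonneg _) (hi (hrc.pow 2))]
    exact le_antisymm hzero (integral_nonneg fun x => sq_nonneg _)
  -- A continuous function that vanishes almost everywhere vanishes on the support, as its nonzero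
  -- set is open and null.
  have hrx : r x = 0 := by
    by_contra hne
    have hopen : {x | r x ≠ 0} ∈ 𝓝 x := (isOpen_ne_fun hrc continuous_const).mem_nhds hne
    have hpos := (Measure.mem_support_iff_forall x).1 hx _ hopen
    refine hpos.ne' (measure_mono_null (fun x hx => ?_) hae)
    simpa using hx
  have hE1 : Real.exp (f x) * ∫ y, Real.exp (g y - C x y) ∂β = 1 := by
    have : 1 - E x = 0 := hrx
    linarith
  rw [Real.exp_neg, inv_eq_of_mul_eq_one_right hE1]

end Optimality
end OnlineSinkhorn

/-! ### Mean error of a sample mean. -/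

namespace OnlineSinkhorn

section Sampling

variable {Ω : Type*} [MeasurableSpace Ω] {P : Measure Ω} [IsProbabilityMeasure P]

/-- Nonnegativity of the variance of `|T - E T|` is the Cauchy–Schwarz inequality needed here. -/
lemma integral_abs_le_sqrt_variance {T : Ω → ℝ} (hT : MemLp T 2 P) :
    ∫ ω, |T ω - ∫ ω, T ω ∂P| ∂P ≤ √(variance T P) := by
  set S : Ω → ℝ := fun ω => |T ω - ∫ ω, T ω ∂P| with hS
  have hS2 : MemLp S 2 P := (hT.sub (memLp_const _)).abs
  refine Real.le_sqrt_of_sq_le ?_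
  have h1 := variance_nonneg S P
  rw [variance_eq_sub hS2] at h1
  rw [variance_eq_integral hT.aestronglyMeasurable.aemeasurable]
  have : ∫ ω, (S ^ 2) ω ∂P = ∫ ω, (T ω - ∫ ω, T ω ∂P) ^ 2 ∂P := by
    congr 1; funext ω; simp [hS]
  rw [← this]
  linarith

variable {X : Type*} [MetricSpace X] [MeasurableSpace X] [BorelSpace X] {β : Measure X}

/-- The mean absolute error of a sample mean. -/
lemma lintegral_sampleMean_sub_le {z : ℕ → Ω → X} (hz : ∀ i, Measurable (z i))
    (hzβ : ∀ i, P.map (z i) = β) (hind : iIndepFun z P) {I : Finset ℕ} (hI : I.Nonempty)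
    {φ : X → ℝ} (hφ : Continuous φ) {c : ℝ} (hc : ∀ x, |φ x| ≤ c) :
    ∫⁻ ω, ‖(I.card : ℝ)⁻¹ * ∑ i ∈ I, φ (z i ω) - ∫ y, φ y ∂β‖ₑ ∂P
      ≤ ENNReal.ofReal (c / √I.card) := by
  have hm : ∀ i, Measurable fun ω => φ (z i ω) := fun i => hφ.measurable.comp (hz i)
  have hL : ∀ i, MemLp (fun ω => φ (z i ω)) 2 P := fun i =>
    MemLp.of_bound (hm i).aestronglyMeasurable c (Eventually.of_forall fun ω => hc _)
  have hint : ∀ i, ∫ ω, φ (z i ω) ∂P = ∫ y, φ y ∂β := fun i => by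
    rw [← hzβ i, integral_map (hz i).aemeasurable hφ.aestronglyMeasurable]
  have hcard : (0 : ℝ) < I.card := by exact_mod_cast hI.card_pos
  set T : Ω → ℝ := fun ω => (I.card : ℝ)⁻¹ * (∑ i ∈ I, fun ω => φ (z i ω)) ω with hT
  have hsumL : MemLp (∑ i ∈ I, fun ω => φ (z i ω)) 2 P := memLp_finsetSum' I fun i _ => hL i
  have hTL : MemLp T 2 P := hsumL.const_mul _
  have hTint : ∫ ω, T ω ∂P = ∫ y, φ y ∂β := by
    rw [hT, integral_const_mul]
    simp only [Finset.sum_apply]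
    rw [integral_finsetSum I fun i _ => (hL i).integrable one_le_two]
    simp only [hint, Finset.sum_const, nsmul_eq_mul]
    field_simp
  have hc0 : 0 ≤ c := by
    obtain ⟨ω⟩ : Nonempty Ω := nonempty_of_isProbabilityMeasure P
    exact (abs_nonneg _).trans (hc (z 0 ω))
  have hvar : variance T P ≤ (c / √I.card) ^ 2 := by
    rw [hT, variance_const_mul, IndepFun.variance_sum (fun i _ => hL i) (fun i _ j _ hij =>
      (hind.indepFun hij).comp hφ.measurable hφ.measurable)]
    have h1 : ∀ i ∈ I, variance (fun ω => φ (z i ω)) P ≤ c ^ 2 := fun i _ => by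
      refine (variance_le_expectation_sq (hm i).aestronglyMeasurable).trans ?_
      have : ∫ ω, c ^ 2 ∂P = c ^ 2 := by simp
      rw [← this]
      refine integral_mono (hL i).integrable_sq (integrable_const _) fun ω => ?_
      exact sq_le_sq' (abs_le.1 (hc _)).1 (abs_le.1 (hc _)).2
    refine (mul_le_mul_of_nonneg_left (Finset.sum_le_card_nsmul I _ _ h1) (sq_nonneg _)).trans ?_
    rw [nsmul_eq_mul, div_pow, Real.sq_sqrt hcard.le]
    refine le_of_eq ?_
    field_simp
  have hfun : (fun ω => ‖(I.card : ℝ)⁻¹ * ∑ i ∈ I, φ (z i ω) - ∫ y, φ y ∂β‖ₑ)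
      = fun ω => ‖T ω - ∫ ω, T ω ∂P‖ₑ := by
    funext ω; rw [hTint]; simp [hT]
  have hTi : Integrable (fun ω => T ω - ∫ ω, T ω ∂P) P :=
    (hTL.integrable one_le_two).sub (integrable_const _)
  rw [hfun, ← ofReal_integral_norm_eq_lintegral_enorm hTi]
  refine ENNReal.ofReal_le_ofReal ((integral_abs_le_sqrt_variance hTL).trans ?_)
  exact Real.sqrt_le_iff.2 ⟨by positivity, hvar⟩

variable [CompactSpace X] [IsProbabilityMeasure β]

/-- The weighted mean absolute error of a sample mean, for a random function that is independent of
the sample. -/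
lemma lintegral_kernel_sampleMean_sub_le [MeasurableSpace C(X, ℝ)] [BorelSpace C(X, ℝ)]
    {z : ℕ → Ω → X} (hz : ∀ i, Measurable (z i)) (hzβ : ∀ i, P.map (z i) = β)
    (hind : iIndepFun z P) {I : Finset ℕ} (hI : I.Nonempty) {k : X → X → ℝ}
    (hk : Continuous fun p : X × X => k p.1 p.2) {c : ℝ} (hc : ∀ x y, |k x y| ≤ c)
    {φ : Ω → C(X, ℝ)} (hφ : Measurable φ) (hφz : IndepFun φ (fun ω (i : I) => z i ω) P)
    (ρ : Measure X) [IsProbabilityMeasure ρ] :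
    ∫⁻ ω, ∫⁻ a, ‖‖φ ω‖⁻¹ * ((I.card : ℝ)⁻¹ * ∑ i ∈ I, k a (z i ω) * φ ω (z i ω)
      - ∫ y, k a y * φ ω y ∂β)‖ₑ ∂ρ ∂P ≤ ENNReal.ofReal (c / √I.card) := by
  set Ψ : C(X, ℝ) × (I → X) → X → ENNReal := fun q a =>
    ‖‖q.1‖⁻¹ * ((I.card : ℝ)⁻¹ * ∑ i : I, k a (q.2 i) * q.1 (q.2 i)
      - ∫ y, k a y * q.1 y ∂β)‖ₑ with hΨ
  have hΨm : Measurable fun r : (C(X, ℝ) × (I → X)) × X => Ψ r.1 r.2 := by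
    have h1 : Continuous fun r : (C(X, ℝ) × (I → X)) × X =>
        (I.card : ℝ)⁻¹ * ∑ i : I, k r.2 (r.1.2 i) * r.1.1 (r.1.2 i) := by
      refine continuous_const.mul (continuous_finsetSum _ fun i _ => ?_)
      refine Continuous.mul ?_ ?_
      · exact hk.comp (by fun_prop : Continuous fun r : (C(X, ℝ) × (I → X)) × X => (r.2, r.1.2 i))
      · fun_prop
    have h2 : StronglyMeasurable fun r : (C(X, ℝ) × (I → X)) × X => ∫ y, k r.2 y * r.1.1 y ∂β := by
      refine StronglyMeasurable.integral_prod_right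
        (f := fun (r : (C(X, ℝ) × (I → X)) × X) y => k r.2 y * r.1.1 y) ?_
      refine Continuous.stronglyMeasurable (Continuous.mul ?_ ?_)
      · exact hk.comp (by fun_prop :
          Continuous fun r : ((C(X, ℝ) × (I → X)) × X) × X => (r.1.2, r.2))
      · fun_prop
    have h3 : Measurable fun r : (C(X, ℝ) × (I → X)) × X => ‖r.1.1‖⁻¹ :=
      (by fun_prop : Continuous fun r : (C(X, ℝ) × (I → X)) × X => ‖r.1.1‖).measurable.inv
    exact (h3.mul (h1.measurable.sub h2.measurable)).enorm
  have hzI : Measurable fun ω (i : I) => z i ω := measurable_pi_lambda _ fun i => hz i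
  have hΨ' : Measurable fun q => ∫⁻ a, Ψ q a ∂ρ := hΨm.lintegral_prod_right
  -- By independence the joint law of the function and the sample is a product, so the function can
  -- be frozen at `p`; a bound uniform in `p` then suffices.
  have hlaw : ∫⁻ ω, ∫⁻ a, Ψ (φ ω, fun i => z i ω) a ∂ρ ∂P
      = ∫⁻ p, ∫⁻ ω, ∫⁻ a, Ψ (p, fun i => z i ω) a ∂ρ ∂P ∂(P.map φ) := by
    rw [← lintegral_map hΨ' (hφ.prodMk hzI),
      (indepFun_iff_map_prod_eq_prod_map_map hφ.aemeasurable hzI.aemeasurable).1 hφz,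
      lintegral_prod _ hΨ'.aemeasurable]
    refine lintegral_congr fun p => ?_
    exact lintegral_map (hΨ'.comp measurable_prodMk_left) hzI
  have hsum : ∀ (p : C(X, ℝ)) (ω : Ω) (a : X), Ψ (p, fun i => z i ω) a =
      ‖(I.card : ℝ)⁻¹ * ∑ i ∈ I, ‖p‖⁻¹ * (k a (z i ω) * p (z i ω))
        - ∫ y, ‖p‖⁻¹ * (k a y * p y) ∂β‖ₑ := by
    intro p ω a
    simp only [hΨ]
    rw [Finset.sum_coe_sort I (fun i => k a (z i ω) * p (z i ω)), integral_const_mul,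
      ← Finset.mul_sum]
    congr 1
    ring
  have hgoal : ∫⁻ ω, ∫⁻ a, ‖‖φ ω‖⁻¹ * ((I.card : ℝ)⁻¹ * ∑ i ∈ I, k a (z i ω) * φ ω (z i ω)
      - ∫ y, k a y * φ ω y ∂β)‖ₑ ∂ρ ∂P = ∫⁻ ω, ∫⁻ a, Ψ (φ ω, fun i => z i ω) a ∂ρ ∂P := by
    simp only [hΨ]
    refine lintegral_congr fun ω => lintegral_congr fun a => ?_
    rw [Finset.sum_coe_sort I (fun i => k a (z i ω) * φ ω (z i ω))]
  rw [hgoal, hlaw]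
  have hfix : ∀ p : C(X, ℝ), ∫⁻ ω, ∫⁻ a, Ψ (p, fun i => z i ω) a ∂ρ ∂P
      ≤ ENNReal.ofReal (c / √I.card) := by
    intro p
    rw [lintegral_lintegral_swap]
    · refine (lintegral_mono (g := fun _ => ENNReal.ofReal (c / √I.card)) fun a => ?_).trans
        (by simp)
      simp only [hsum]
      refine lintegral_sampleMean_sub_le (φ := fun y => ‖p‖⁻¹ * (k a y * p y)) hz hzβ hind hI ?_ ?_
      · have := hk.comp (Continuous.prodMk_right a)
        exact continuous_const.mul (Continuous.mul this p.continuous)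
      · intro x
        have hc0 : 0 ≤ c := (abs_nonneg _).trans (hc x x)
        rw [abs_mul, abs_mul, abs_inv, abs_norm]
        have h1 : |p x| ≤ ‖p‖ := p.norm_coe_le_norm x
        calc ‖p‖⁻¹ * (|k a x| * |p x|) ≤ ‖p‖⁻¹ * (c * ‖p‖) := by
              have := mul_le_mul (hc a x) h1 (abs_nonneg _) hc0
              gcongr
          _ = c * (‖p‖⁻¹ * ‖p‖) := by ring
          -- Only an inequality, because `p` may be zero and then `‖p‖⁻¹ = 0`.
          _ ≤ c * 1 := mul_le_mul_of_nonneg_left (inv_mul_le_one) hc0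
          _ = c := mul_one c
    · exact (hΨm.comp ((measurable_const.prodMk (hzI.comp measurable_fst)).prodMk
        measurable_snd)).aemeasurable
  have hpr : IsProbabilityMeasure (P.map φ) := Measure.isProbabilityMeasure_map hφ.aemeasurable
  exact (lintegral_mono hfix).trans (by simp)

end Sampling
end OnlineSinkhorn

/-! ### Mini-batches and summability of their errors. -/

namespace OnlineSinkhorn

section Batches

variable {X : Type*}

lemma samplesBefore_succ (n : ℕ → ℕ) (t : ℕ) :
    samplesBefore n (t + 1) = samplesBefore n t + n t :=
  Finset.sum_range_succ _ _

/-- The indices of the samples in the `t`-th batch. -/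
def batchIndices (n : ℕ → ℕ) (t : ℕ) : Finset ℕ :=
  Finset.Ico (samplesBefore n t) (samplesBefore n (t + 1))

lemma card_batchIndices (n : ℕ → ℕ) (t : ℕ) : (batchIndices n t).card = n t := by
  rw [batchIndices, Nat.card_Ico, samplesBefore_succ, Nat.add_sub_cancel_left]

lemma isProbabilityMeasure_batchMeasure [MeasurableSpace X] {n : ℕ → ℕ} {t : ℕ} (hn : n t ≠ 0)
    (z : ℕ → X) : IsProbabilityMeasure (batchMeasure n z t) := by
  constructor
  change ((n t : ENNReal)⁻¹ • ∑ i ∈ batchIndices n t, Measure.dirac (z i)) Set.univ = 1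
  simp only [Measure.smul_apply, Measure.finsetSum_apply, measure_univ, Finset.sum_const,
    card_batchIndices, smul_eq_mul, nsmul_eq_mul, mul_one]
  exact ENNReal.inv_mul_cancel (by exact_mod_cast hn) (ENNReal.natCast_ne_top _)

lemma integral_batchMeasure [MeasurableSpace X] [MeasurableSingletonClass X] (n : ℕ → ℕ)
    (z : ℕ → X) (t : ℕ) (h : X → ℝ) :
    ∫ y, h y ∂(batchMeasure n z t) = (n t : ℝ)⁻¹ * ∑ i ∈ batchIndices n t, h (z i) := by
  have : batchMeasure n z t = (n t : ENNReal)⁻¹ • ∑ i ∈ batchIndices n t, Measure.dirac (z i) := rfl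
  rw [this, integral_smul_measure, integral_finsetSum_measure fun i _ => integrable_dirac (by simp)]
  simp [integral_dirac]

variable {Ω : Type*} [MeasurableSpace Ω] {P : Measure Ω} [IsProbabilityMeasure P]
  [MetricSpace X] [CompactSpace X] [MeasurableSpace X] [BorelSpace X]
  {β : Measure X} [IsProbabilityMeasure β]

/-- The weighted sampling errors are almost surely summable against the step sizes. -/
theorem ae_summable_sampling_error [MeasurableSpace C(X, ℝ)] [BorelSpace C(X, ℝ)]
    {n : ℕ → ℕ} {η w : ℕ → ℝ} {B : ℝ} (hB : 0 < B) (hw : ∀ t, 0 < w t)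
    (hn : ∀ t, (n t : ℝ) = B / w t ^ 2) (hη0 : ∀ t, 0 ≤ η t) (hwη : Summable fun t => w t * η t)
    {z : ℕ → Ω → X} (hz : ∀ i, Measurable (z i)) (hzβ : ∀ i, P.map (z i) = β)
    (hind : iIndepFun z P) {k : X → X → ℝ} (hk : Continuous fun p : X × X => k p.1 p.2)
    {φ : ℕ → Ω → C(X, ℝ)} (hφ : ∀ t, Measurable (φ t))
    (hφz : ∀ t, IndepFun (φ t) (fun ω (i : batchIndices n t) => z i ω) P)
    (ρ : Measure X) [IsProbabilityMeasure ρ] :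
    ∀ᵐ ω ∂P, Summable fun t => η t * (‖φ t ω‖⁻¹ * ∫ a,
      |∫ y, k a y * φ t ω y ∂(batchMeasure n (fun i => z i ω) t) - ∫ y, k a y * φ t ω y ∂β| ∂ρ) := by
  obtain ⟨c, hc⟩ := isCompact_univ.exists_bound_of_continuousOn hk.continuousOn
  have hc' : ∀ x y, |k x y| ≤ c := fun x y => hc (x, y) (Set.mem_univ _)
  have hnpos : ∀ t, (0 : ℝ) < n t := fun t => by rw [hn]; have := hw t; positivity
  set N : ℕ → Ω → X → ℝ := fun t ω a => ‖φ t ω‖⁻¹ *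
    ((n t : ℝ)⁻¹ * ∑ i ∈ batchIndices n t, k a (z i ω) * φ t ω (z i ω)
      - ∫ y, k a y * φ t ω y ∂β) with hN
  have hNc : ∀ t ω, Continuous (N t ω) := by
    intro t ω
    refine continuous_const.mul (Continuous.sub (continuous_const.mul
      (continuous_finsetSum _ fun i _ => ?_)) ?_)
    · exact (hk.comp (Continuous.prodMk_left (z i ω))).mul continuous_const
    · exact continuous_integral_right (F := fun a y => k a y * φ t ω y)
        (hk.mul ((φ t ω).continuous.comp continuous_snd)) β
  have hmean : ∀ t, ∫⁻ ω, ∫⁻ a, ‖N t ω a‖ₑ ∂ρ ∂P ≤ ENNReal.ofReal (c / √B * w t) := by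
    intro t
    have hI : (batchIndices n t).Nonempty := by
      rw [← Finset.card_pos, card_batchIndices]; exact_mod_cast hnpos t
    have := lintegral_kernel_sampleMean_sub_le hz hzβ hind hI hk hc' (hφ t) (hφz t) ρ
    rw [card_batchIndices] at this
    refine this.trans (ENNReal.ofReal_le_ofReal (le_of_eq ?_))
    rw [hn, Real.sqrt_div hB.le, Real.sqrt_sq (hw t).le]
    field_simp
  have hmeas : ∀ t, AEMeasurable (fun ω => ∫⁻ a, ‖N t ω a‖ₑ ∂ρ) P := by
    intro t
    refine (Measurable.lintegral_prod_right' (f := fun r : Ω × X => ‖N t r.1 r.2‖ₑ)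
      (Measurable.enorm ?_)).aemeasurable
    have h1 : Measurable fun r : Ω × X => φ t r.1 := (hφ t).comp measurable_fst
    have hev : Measurable fun q : C(X, ℝ) × X => q.1 q.2 :=
      (by fun_prop : Continuous fun q : C(X, ℝ) × X => q.1 q.2).measurable
    refine (continuous_norm.measurable.comp h1).inv.mul (Measurable.sub (measurable_const.mul
      (Finset.measurable_sum _ fun i _ => ?_)) ?_)
    · have h2 : Measurable fun r : Ω × X => z i r.1 := (hz i).comp measurable_fst
      exact (hk.measurable.comp (measurable_snd.prodMk h2)).mul (hev.comp (h1.prodMk h2))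
    · refine (StronglyMeasurable.integral_prod_right
        (f := fun (r : Ω × X) y => k r.2 y * φ t r.1 y) ?_).measurable
      refine Measurable.stronglyMeasurable (Measurable.mul ?_ ?_)
      · exact hk.measurable.comp ((measurable_snd.comp measurable_fst).prodMk measurable_snd)
      · exact hev.comp ((h1.comp measurable_fst).prodMk measurable_snd)
  -- By Tonelli the expected sum is at most `c / √B * ∑ w t * η t`, because `n t = B / w t ^ 2`; a
  -- finite expectation makes the sum almost surely finite.
  have hfin : ∫⁻ ω, ∑' t, ENNReal.ofReal (η t) * ∫⁻ a, ‖N t ω a‖ₑ ∂ρ ∂P ≠ ⊤ := by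
    rw [lintegral_tsum fun t => (hmeas t).const_mul _]
    simp only [lintegral_const_mul'' _ (hmeas _)]
    have hsum : Summable fun t => η t * (c / √B * w t) := by
      refine (hwη.mul_left (c / √B)).congr fun t => ?_
      ring
    refine ne_top_of_le_ne_top hsum.tsum_ofReal_ne_top (ENNReal.tsum_le_tsum fun t => ?_)
    rw [ENNReal.ofReal_mul (hη0 t)]
    exact mul_le_mul_right (hmean t) _
  filter_upwards [ae_lt_top' (AEMeasurable.tsum fun t => (hmeas t).const_mul _) hfin]
    with ω hω
  have hreal : ∀ t, ENNReal.ofReal (η t) * ∫⁻ a, ‖N t ω a‖ₑ ∂ρ = ENNReal.ofReal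
      (η t * (‖φ t ω‖⁻¹ * ∫ a, |∫ y, k a y * φ t ω y ∂(batchMeasure n (fun i => z i ω) t)
        - ∫ y, k a y * φ t ω y ∂β| ∂ρ)) := by
    intro t
    rw [← ofReal_integral_norm_eq_lintegral_enorm ((hNc t ω).integrable_of_compactSpace ρ),
      ← ENNReal.ofReal_mul (hη0 t)]
    congr 2
    rw [← integral_const_mul]
    congr 1
    funext a
    rw [integral_batchMeasure, hN, Real.norm_eq_abs, abs_mul, abs_inv, abs_norm]
  have hnn : ∀ t, 0 ≤ η t * (‖φ t ω‖⁻¹ * ∫ a, |∫ y, k a y * φ t ω y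
      ∂(batchMeasure n (fun i => z i ω) t) - ∫ y, k a y * φ t ω y ∂β| ∂ρ) := fun t =>
    mul_nonneg (hη0 t) (mul_nonneg (by positivity) (integral_nonneg fun a => abs_nonneg _))
  simp only [hreal] at hω
  exact (ENNReal.summable_toReal hω.ne).congr fun t => ENNReal.toReal_ofReal (hnn t)

end Batches
end OnlineSinkhorn

/-! ### From the potentials to the relative iterates and back. -/

namespace OnlineSinkhorn

section Iterates

/-- Exchanging the roles is possible because the updates are simultaneous: neither of them uses the
new value of the other potential. -/
lemma iterates_flip {X : Type*} [MeasurableSpace X] (C : X → X → ℝ) (η : ℕ → ℝ) (n : ℕ → ℕ)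
    (x y : ℕ → X) (f₀ g₀ : X → ℝ) (t : ℕ) :
    iterates (flip C) η n y x g₀ f₀ t = (iterates C η n x y f₀ g₀ t).swap := by
  induction t with
  | zero => rfl
  | succ t ih => simp only [iterates, ih, Prod.fst_swap, Prod.snd_swap, Prod.swap_prod_mk]; rfl

lemma convex_combination_pos {η p q : ℝ} (h0 : 0 ≤ η) (h1 : η ≤ 1) (hp : 0 < p) (hq : 0 < q) :
    0 < (1 - η) * p + η * q := by
  have := (convex_Ioi (0 : ℝ)) hp hq (sub_nonneg.2 h1) h0 (by ring)
  simpa using this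

lemma sampleMean_exp_pos {X : Type*} {n : ℕ → ℕ} (hn : ∀ t, n t ≠ 0) (g h : X → ℝ)
    (z : ℕ → X) (t : ℕ) : 0 < (n t : ℝ)⁻¹ * ∑ i ∈ batchIndices n t, Real.exp (g (z i) - h (z i)) := by
  have h1 : (0 : ℝ) < n t := by exact_mod_cast Nat.pos_of_ne_zero (hn t)
  refine mul_pos (inv_pos.2 h1) (Finset.sum_pos (fun i _ => Real.exp_pos _) ?_)
  rw [← Finset.card_pos, card_batchIndices]
  exact Nat.pos_of_ne_zero (hn t)

variable {X : Type*} [MetricSpace X] [MeasurableSpace X] [BorelSpace X]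
  {C : X → X → ℝ} {η : ℕ → ℝ} {n : ℕ → ℕ}

lemma iterates_fst_succ (hn : ∀ t, n t ≠ 0) (x y : ℕ → X) (f₀ g₀ : X → ℝ) (t : ℕ) (a : X) :
    (iterates C η n x y f₀ g₀ (t + 1)).1 a = -Real.log ((1 - η t) *
      Real.exp (-(iterates C η n x y f₀ g₀ t).1 a) + η t * ((n t : ℝ)⁻¹ *
        ∑ i ∈ batchIndices n t, Real.exp ((iterates C η n x y f₀ g₀ t).2 (y i) - C a (y i)))) := by
  simp only [iterates, softCTransform, neg_neg, integral_batchMeasure]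
  rw [Real.exp_log (sampleMean_exp_pos hn _ (C a) y t)]

lemma exp_neg_iterates_fst_succ (hn : ∀ t, n t ≠ 0) (hη0 : ∀ t, 0 ≤ η t) (hη1 : ∀ t, η t ≤ 1)
    (x y : ℕ → X) (f₀ g₀ : X → ℝ) (t : ℕ) (a : X) :
    Real.exp (-(iterates C η n x y f₀ g₀ (t + 1)).1 a) =
      (1 - η t) * Real.exp (-(iterates C η n x y f₀ g₀ t).1 a)
        + η t * ∫ b, Real.exp ((iterates C η n x y f₀ g₀ t).2 b - C a b) ∂(batchMeasure n y t) := by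
  rw [iterates_fst_succ hn, neg_neg, Real.exp_log (convex_combination_pos (hη0 t) (hη1 t)
    (Real.exp_pos _) (sampleMean_exp_pos hn _ (C a) y t)), integral_batchMeasure]

lemma continuous_iterates_fst_succ (hC : Continuous fun p : X × X => C p.1 p.2)
    (hn : ∀ t, n t ≠ 0) (hη0 : ∀ t, 0 ≤ η t) (hη1 : ∀ t, η t ≤ 1) (x y : ℕ → X) (f₀ g₀ : X → ℝ)
    {t : ℕ} (hf : Continuous (iterates C η n x y f₀ g₀ t).1) :
    Continuous (iterates C η n x y f₀ g₀ (t + 1)).1 := by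
  rw [funext fun a => iterates_fst_succ (C := C) (η := η) hn x y f₀ g₀ t a]
  refine (Continuous.log ?_ fun a => (convex_combination_pos (hη0 t) (hη1 t)
    (Real.exp_pos _) (sampleMean_exp_pos hn _ (C a) y t)).ne').neg
  have hCi : ∀ i, Continuous fun a => C a (y i) := fun i => hC.comp (Continuous.prodMk_left (y i))
  fun_prop

lemma continuous_iterates (hC : Continuous fun p : X × X => C p.1 p.2)
    (hn : ∀ t, n t ≠ 0) (hη0 : ∀ t, 0 ≤ η t) (hη1 : ∀ t, η t ≤ 1) (x y : ℕ → X) {f₀ g₀ : X → ℝ}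
    (hf : Continuous f₀) (hg : Continuous g₀) (t : ℕ) :
    Continuous (iterates C η n x y f₀ g₀ t).1 ∧ Continuous (iterates C η n x y f₀ g₀ t).2 := by
  induction t with
  | zero => exact ⟨hf, hg⟩
  | succ t ih =>
    refine ⟨continuous_iterates_fst_succ hC hn hη0 hη1 x y f₀ g₀ ih.1, ?_⟩
    have h := continuous_iterates_fst_succ (C := flip C) (hC.comp continuous_swap) hn hη0 hη1
      y x g₀ f₀ (t := t) (by rw [iterates_flip]; exact ih.2)
    rwa [iterates_flip] at h

variable [CompactSpace X]

/-- The online Sinkhorn iterates relative to optimal potentials. -/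
lemma IsOptimalPotentials.exists_relativeIterates {α β : Measure X} [IsProbabilityMeasure α]
    [IsProbabilityMeasure β] {f g : X → ℝ} (h : IsOptimalPotentials C α β f g)
    (hC : Continuous fun p : X × X => C p.1 p.2)
    (hn : ∀ t, n t ≠ 0) (hη0 : ∀ t, 0 ≤ η t) (hη1 : ∀ t, η t ≤ 1) (x y : ℕ → X) {f₀ g₀ : X → ℝ}
    (hf₀ : Continuous f₀) (hg₀ : Continuous g₀) :
    ∃ δ Λ, RelativeIterates (fun x y => Real.exp (f x + g y - C x y)) α β (batchMeasure n x)
      (batchMeasure n y) η δ Λ (fun t a => Real.exp (f a - (iterates C η n x y f₀ g₀ t).1 a))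
      (fun t b => Real.exp (g b - (iterates C η n x y f₀ g₀ t).2 b)) := by
  have hf := h.continuous_left
  have hg := h.continuous_right
  have hc : Continuous fun p : X × X => f p.1 + g p.2 - C p.1 p.2 := by fun_prop
  obtain ⟨R, hR⟩ := isCompact_univ.exists_bound_of_continuousOn hc.continuousOn
  have hR' : ∀ x y, |f x + g y - C x y| ≤ R := fun x y => hR (x, y) (Set.mem_univ _)
  have hmarg : ∀ {C : X → X → ℝ} {α β : Measure X} [IsProbabilityMeasure α]
      [IsProbabilityMeasure β] {f g : X → ℝ}, IsOptimalPotentials C α β f g →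
      (Continuous fun p : X × X => C p.1 p.2) →
      ∀ x, ∫ y, Real.exp (f x + g y - C x y) ∂β = 1 := by
    intro C α β _ _ f g h hC x
    simp only [add_sub_assoc, Real.exp_add (f x)]
    rw [integral_const_mul, ← h.exp_neg_left hC x, ← Real.exp_add, add_neg_cancel, Real.exp_zero]
  have hstep : ∀ (C : X → X → ℝ) (f g : X → ℝ) (x y : ℕ → X) (f₀ g₀ : X → ℝ) (t : ℕ) (a : X),
      Real.exp (f a - (iterates C η n x y f₀ g₀ (t + 1)).1 a)
        = (1 - η t) * Real.exp (f a - (iterates C η n x y f₀ g₀ t).1 a)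
          + η t * ∫ b, Real.exp (f a + g b - C a b) /
            Real.exp (g b - (iterates C η n x y f₀ g₀ t).2 b) ∂(batchMeasure n y t) := by
    intro C f g x y f₀ g₀ t a
    have hsplit : ∀ s, Real.exp (f a - (iterates C η n x y f₀ g₀ s).1 a)
        = Real.exp (f a) * Real.exp (-(iterates C η n x y f₀ g₀ s).1 a) := fun s => by
      rw [sub_eq_add_neg, Real.exp_add]
    rw [hsplit, hsplit, exp_neg_iterates_fst_succ hn hη0 hη1]
    -- The optimal `g` cancels between the kernel and the relative iterate, so the recursion in
    -- relative coordinates is exact for any batch.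
    have : ∀ b, Real.exp (f a + g b - C a b) / Real.exp (g b - (iterates C η n x y f₀ g₀ t).2 b)
        = Real.exp (f a) * Real.exp ((iterates C η n x y f₀ g₀ t).2 b - C a b) := by
      intro b; rw [← Real.exp_sub, ← Real.exp_add]; ring_nf
    simp only [this, integral_const_mul]
    ring
  refine ⟨Real.exp (-R), Real.exp R, ?_⟩
  exact {
    continuous_kernel := Real.continuous_exp.comp hc
    kernel_pos := Real.exp_pos _
    le_kernel := fun x y => Real.exp_le_exp.2 (abs_le.1 (hR' x y)).1
    kernel_le := fun x y => Real.exp_le_exp.2 (abs_le.1 (hR' x y)).2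
    marginal_left := hmarg h hC
    marginal_right := fun y => by
      have := hmarg h.symm (hC.comp continuous_swap) y
      simpa only [flip, add_comm (g y)] using this
    step_nonneg := hη0
    step_le_one := hη1
    continuous_left := fun t => Real.continuous_exp.comp
      (hf.sub (continuous_iterates hC hn hη0 hη1 x y hf₀ hg₀ t).1)
    continuous_right := fun t => Real.continuous_exp.comp
      (hg.sub (continuous_iterates hC hn hη0 hη1 x y hf₀ hg₀ t).2)
    left_pos := fun _ _ => Real.exp_pos _
    right_pos := fun _ _ => Real.exp_pos _
    left_succ := hstep C f g x y f₀ g₀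
    right_succ := fun t b => by
      have := hstep (flip C) g f y x g₀ f₀ t b
      simpa only [iterates_flip, Prod.fst_swap, Prod.snd_swap, flip, add_comm (g b)] using this }

end Iterates

lemma varNorm_nonneg {X : Type*} [TopologicalSpace X] [CompactSpace X] [Nonempty X] {h : X → ℝ}
    (hc : Continuous h) : 0 ≤ varNorm h := by
  obtain ⟨x⟩ := ‹Nonempty X›
  exact sub_nonneg.2 ((ciInf_le (isCompact_range hc).bddBelow x).trans
    (le_ciSup (isCompact_range hc).bddAbove x))

lemma varNorm_le {X : Type*} [Nonempty X] {h : X → ℝ} {ε : ℝ} (hε : ∀ x x', h x ≤ h x' + ε) :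
    varNorm h ≤ ε := by
  have : ⨆ x, h x ≤ (⨅ x, h x) + ε := by
    refine ciSup_le fun x => ?_
    have := le_ciInf fun x' => sub_le_iff_le_add.2 (hε x x')
    linarith
  rw [varNorm]
  linarith

/-- Since `1 + ε ≤ exp ε`, proportionality up to `1 + ε` suffices; the unknown constant of
proportionality drops out of the seminorm. -/
lemma varNorm_sub_le_of_exp_le {X : Type*} [Nonempty X] {f fstar : X → ℝ} {ε : ℝ}
    (h : ∀ x x', Real.exp (fstar x - f x) ≤ (1 + ε) * Real.exp (fstar x' - f x')) :
    varNorm (fun x => f x - fstar x) ≤ ε := by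
  refine varNorm_le fun x x' => ?_
  have h1 := h x' x
  have h2 : (1 + ε) * Real.exp (fstar x - f x) ≤ Real.exp (ε + (fstar x - f x)) := by
    rw [Real.exp_add]
    exact mul_le_mul_of_nonneg_right (by linarith [Real.add_one_le_exp ε]) (Real.exp_pos _).le
  have := Real.exp_le_exp.1 (h1.trans h2)
  linarith

/-- Transfer of the summability of the sampling errors from the potentials to the relative
iterates. -/
lemma RelativeIterates.summable_samplingError {X : Type*} [MetricSpace X] [CompactSpace X]
    [MeasurableSpace X] [BorelSpace X] {C : X → X → ℝ} {f g : X → ℝ} {α β : Measure X}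
    {αs βs : ℕ → Measure X} [∀ t, IsProbabilityMeasure (αs t)] [∀ t, IsProbabilityMeasure (βs t)]
    {η : ℕ → ℝ} {δ Λ : ℝ} {a : ℕ → X → ℝ} {G : ℕ → X → ℝ}
    (h : RelativeIterates (fun x y => Real.exp (f x + g y - C x y)) α β αs βs η δ Λ a
      (fun t y => Real.exp (g y - G t y)))
    (hf : Continuous f) (hg : Continuous g)
    (φ : ℕ → C(X, ℝ)) (hφ : ∀ t y, φ t y = Real.exp (G t y)) (x₀ : X) {ρ : Measure X}
    (hs : Summable fun t => η t * (‖φ t‖⁻¹ * ∫ x, |∫ y, Real.exp (-C x y) * φ t y ∂(βs t)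
      - ∫ y, Real.exp (-C x y) * φ t y ∂β| ∂ρ)) [IsProbabilityMeasure ρ] [IsProbabilityMeasure β] :
    Summable fun t => η t * (Real.exp (g x₀ - G t x₀) *
      ∫ x, |samplingError (fun x y => Real.exp (f x + g y - C x y)) β (βs t)
        (fun y => Real.exp (g y - G t y)) x| ∂ρ) := by
  have : Nonempty X := ⟨x₀⟩
  obtain ⟨K, hK1, hK⟩ := h.exists_oscillation_bound
  obtain ⟨cf, hcf⟩ := isCompact_univ.exists_bound_of_continuousOn
    (Real.continuous_exp.comp hf).continuousOn
  obtain ⟨cg, hcg⟩ := isCompact_univ.exists_bound_of_continuousOn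
    (Real.continuous_exp.comp hg).continuousOn
  have hcf' : ∀ x, Real.exp (f x) ≤ cf := fun x => (le_abs_self _).trans (hcf x (Set.mem_univ x))
  have hcg' : ∀ x, Real.exp (g x) ≤ cg := fun x => (le_abs_self _).trans (hcg x (Set.mem_univ x))
  have hcf0 : 0 < cf := (Real.exp_pos _).trans_le (hcf' x₀)
  have hcg0 : 0 < cg := (Real.exp_pos _).trans_le (hcg' x₀)
  have herr : ∀ t x, samplingError (fun x y => Real.exp (f x + g y - C x y)) β (βs t)
      (fun y => Real.exp (g y - G t y)) x = Real.exp (f x) *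
        (∫ y, Real.exp (-C x y) * φ t y ∂(βs t) - ∫ y, Real.exp (-C x y) * φ t y ∂β) := by
    intro t x
    have : ∀ y, Real.exp (f x + g y - C x y) / Real.exp (g y - G t y)
        = Real.exp (f x) * (Real.exp (-C x y) * φ t y) := by
      intro y; rw [hφ, ← Real.exp_sub, ← Real.exp_add, ← Real.exp_add]; ring_nf
    simp only [samplingError, this, integral_const_mul, mul_sub]
  -- The two normalizations agree up to constants: by the oscillation bound, `exp (G t)` is
  -- comparable to its maximum at `x₀`, so the weight `‖φ t‖⁻¹` dominates the value of the relative
  -- iterate there.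
  have hscale : ∀ t, Real.exp (g x₀ - G t x₀) ≤ K * cg * ‖φ t‖⁻¹ := by
    intro t
    have hpos : 0 < ‖φ t‖ := by
      refine lt_of_lt_of_le ?_ ((φ t).norm_coe_le_norm x₀)
      rw [hφ]; simp [Real.exp_pos]
    rw [← div_eq_mul_inv, le_div_iff₀ hpos, mul_comm, ← le_div_iff₀ (Real.exp_pos _)]
    refine (ContinuousMap.norm_le _ (by positivity)).2 fun y => ?_
    rw [hφ, Real.norm_eq_abs, abs_of_pos (Real.exp_pos _), le_div_iff₀ (Real.exp_pos _)]
    have h1 := mul_le_mul_of_nonneg_left (hK t x₀ y).2 (Real.exp_pos (G t y)).le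
    have h2 : Real.exp (G t y) * Real.exp (g y - G t y) = Real.exp (g y) := by
      rw [← Real.exp_add]; ring_nf
    have h3 := mul_le_mul_of_nonneg_left (hcg' y) (by linarith : (0 : ℝ) ≤ K)
    rw [← h2] at h3
    linarith
  have hcD : ∀ t, Continuous fun x => samplingError (fun x y => Real.exp (f x + g y - C x y)) β
      (βs t) (fun y => Real.exp (g y - G t y)) x := fun t => h.continuous_samplingError t
  refine Summable.of_nonneg_of_le (fun t => mul_nonneg (h.step_nonneg t)
    (mul_nonneg (Real.exp_pos _).le (integral_nonneg fun _ => abs_nonneg _))) (fun t => ?_)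
    (hs.mul_left (K * cg * cf))
  have hD : Continuous fun x => ∫ y, Real.exp (-C x y) * φ t y ∂(βs t)
      - ∫ y, Real.exp (-C x y) * φ t y ∂β := by
    have e : (fun x => ∫ y, Real.exp (-C x y) * φ t y ∂(βs t)
      - ∫ y, Real.exp (-C x y) * φ t y ∂β) = fun x => Real.exp (-f x) *
        samplingError (fun x y => Real.exp (f x + g y - C x y)) β (βs t)
          (fun y => Real.exp (g y - G t y)) x := by
      funext x; rw [herr, ← mul_assoc, ← Real.exp_add]; simp
    rw [e]
    exact (Real.continuous_exp.comp hf.neg).mul (hcD t)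
  have hint : ∫ x, |samplingError (fun x y => Real.exp (f x + g y - C x y)) β (βs t)
      (fun y => Real.exp (g y - G t y)) x| ∂ρ ≤ cf * ∫ x, |∫ y, Real.exp (-C x y) * φ t y ∂(βs t)
      - ∫ y, Real.exp (-C x y) * φ t y ∂β| ∂ρ := by
    rw [← integral_const_mul]
    refine integral_mono ((hcD t).abs.integrable_of_compactSpace ρ)
      ((hD.abs.const_mul cf).integrable_of_compactSpace ρ) fun x => ?_
    rw [herr, abs_mul, abs_of_pos (Real.exp_pos _)]
    exact mul_le_mul_of_nonneg_right (hcf' x) (abs_nonneg _)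
  calc _ ≤ η t * (K * cg * ‖φ t‖⁻¹ * (cf * ∫ x, |∫ y, Real.exp (-C x y) * φ t y ∂(βs t)
        - ∫ y, Real.exp (-C x y) * φ t y ∂β| ∂ρ)) :=
        mul_le_mul_of_nonneg_left (mul_le_mul (hscale t) hint
          (integral_nonneg fun _ => abs_nonneg _) (by positivity)) (h.step_nonneg t)
    _ = _ := by ring

end OnlineSinkhorn

/-! ### Independence of the current potentials and the next batch. -/

namespace OnlineSinkhorn

section Independence

/-- A random variable that is independent of an independent sequence extends it to an independent
family. -/
lemma iIndep_option_elim_comap {Ω γ κ : Type*} [MeasurableSpace Ω] [MeasurableSpace γ]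
    [MeasurableSpace κ] {P : Measure Ω} [IsProbabilityMeasure P] {Z : ℕ → Ω → γ} {U : Ω → κ}
    (hind : iIndepFun Z P) (hUZ : IndepFun U (fun ω i => Z i ω) P) :
    iIndep (fun j : Option ℕ => j.elim (MeasurableSpace.comap U inferInstance)
      fun i => MeasurableSpace.comap (Z i) inferInstance) P := by
  rw [iIndep_iff]
  intro s f hf
  -- A finite intersection of events of single `Z i` is an event of the whole sequence, so the
  -- independence of `U` from the sequence applies to it.
  have hprod : ∀ s' : Finset ℕ, (∀ i ∈ s', some i ∈ s) →
      ∃ A, MeasurableSet A ∧ ⋂ i ∈ s', f (some i) = (fun ω i => Z i ω) ⁻¹' A ∧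
        P (⋂ i ∈ s', f (some i)) = ∏ i ∈ s', P (f (some i)) := by
    intro s' hs'
    have h1 : ∀ i, ∃ B, MeasurableSet B ∧ (i ∈ s' → Z i ⁻¹' B = f (some i)) := by
      intro i
      by_cases hi : i ∈ s'
      · obtain ⟨B, hB, hBf⟩ := hf (some i) (hs' i hi)
        exact ⟨B, hB, fun _ => hBf⟩
      · exact ⟨Set.univ, MeasurableSet.univ, fun h => absurd h hi⟩
    choose B hB hBf using h1
    refine ⟨⋂ i ∈ s', (fun v : ℕ → γ => v i) ⁻¹' B i,
      Finset.measurableSet_biInter s' fun i _ => measurable_pi_apply i (hB i), ?_, ?_⟩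
    · ext ω
      simp only [Set.mem_iInter, Set.mem_preimage]
      refine forall₂_congr fun i hi => ?_
      rw [← hBf i hi, Set.mem_preimage]
    · have := hind.measure_inter_preimage_eq_mul s' (sets := B) fun i _ => hB i
      rw [Set.iInter₂_congr fun i hi => (hBf i hi).symm, this]
      exact Finset.prod_congr rfl fun i hi => by rw [hBf i hi]
  obtain ⟨A, hA, hAeq, hAP⟩ := hprod s.eraseNone fun i hi => Finset.mem_eraseNone.1 hi
  have e1 : ⋂ j ∈ s.eraseNone.map Function.Embedding.some, f j
      = ⋂ i ∈ s.eraseNone, f (some i) := by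
    ext ω
    simp only [Set.mem_iInter, Finset.mem_map]
    refine ⟨fun h i hi => h _ ⟨i, hi, rfl⟩, ?_⟩
    rintro h _ ⟨i, hi, rfl⟩
    exact h i hi
  by_cases hs : none ∈ s
  · obtain ⟨B, hB, hBf⟩ := hf none hs
    have hsplit : s = insert none (s.eraseNone.map Function.Embedding.some) := by
      rw [Finset.map_some_eraseNone, Finset.insert_erase hs]
    rw [hsplit, Finset.set_biInter_insert, Finset.prod_insert (by simp)]
    rw [e1, Finset.prod_map, hAeq, ← hBf, hUZ.measure_inter_preimage_eq_mul _ _ hB hA, ← hAeq, hAP]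
    rfl
  · have hsplit : s = s.eraseNone.map Function.Embedding.some := by
      rw [Finset.map_some_eraseNone, Finset.erase_eq_of_notMem hs]
    rw [hsplit]
    rw [e1, Finset.prod_map, hAP]
    rfl

variable {X : Type*} [MetricSpace X] [CompactSpace X] [MeasurableSpace X] [BorelSpace X]
  [MeasurableSpace C(X, ℝ)] [BorelSpace C(X, ℝ)] {C : X → X → ℝ}

/-- Evaluation is jointly continuous on `C(X, ℝ) × X`, so by currying the new potential depends
continuously on the old ones and on the batch points. The σ-algebra on `Ω` is left free, to be used
with that of the past. -/
lemma measurable_update {Ω : Type*} {m : MeasurableSpace Ω}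
    (hC : Continuous fun p : X × X => C p.1 p.2) {η : ℝ} (hη0 : 0 ≤ η) (hη1 : η ≤ 1) {n : ℕ → ℕ}
    (hn : ∀ t, n t ≠ 0) {t : ℕ} {f g F : Ω → C(X, ℝ)} (hf : Measurable f) (hg : Measurable g)
    {z : ℕ → Ω → X} (hz : ∀ i ∈ batchIndices n t, Measurable (z i))
    (hF : ∀ ω a, F ω a = -Real.log ((1 - η) * Real.exp (-f ω a) + η * ((n t : ℝ)⁻¹ *
      ∑ i ∈ batchIndices n t, Real.exp (g ω (z i ω) - C a (z i ω))))) : Measurable F := by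
  set I := batchIndices n t with hI
  have hcard : (0 : ℝ) < n t := by exact_mod_cast Nat.pos_of_ne_zero (hn t)
  have hIne : I.Nonempty := by
    rw [← Finset.card_pos, hI, card_batchIndices]; exact Nat.pos_of_ne_zero (hn t)
  have hIne' : (Finset.univ : Finset I).Nonempty := Finset.univ_nonempty_iff.2 hIne.to_subtype
  have hcont : Continuous fun r : ((C(X, ℝ) × C(X, ℝ)) × (I → X)) × X =>
      -Real.log ((1 - η) * Real.exp (-r.1.1.1 r.2) + η * ((n t : ℝ)⁻¹ *
        ∑ i : I, Real.exp (r.1.1.2 (r.1.2 i) - C r.2 (r.1.2 i)))) := by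
    refine (Continuous.log ?_ fun r => (convex_combination_pos hη0 hη1 (Real.exp_pos _)
      (mul_pos (inv_pos.2 hcard) (Finset.sum_pos (fun i _ => Real.exp_pos _) hIne'))).ne').neg
    have hCi : ∀ i : I, Continuous fun r : ((C(X, ℝ) × C(X, ℝ)) × (I → X)) × X =>
        C r.2 (r.1.2 i) := fun i =>
      hC.comp (by fun_prop : Continuous fun r : ((C(X, ℝ) × C(X, ℝ)) × (I → X)) × X =>
        (r.2, r.1.2 i))
    fun_prop
  have hFeq : F = (ContinuousMap.curry ⟨_, hcont⟩) ∘ fun ω => ((f ω, g ω), fun i : I => z i ω) := by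
    funext ω
    ext a
    rw [hF, ← Finset.sum_coe_sort I (fun i => Real.exp (g ω (z i ω) - C a (z i ω)))]
    rfl
  rw [hFeq]
  exact (ContinuousMap.continuous _).measurable.comp
    ((hf.prodMk hg).prodMk (measurable_pi_lambda _ fun i => hz i i.2))

variable {Ω : Type*} [MeasurableSpace Ω] {P : Measure Ω} [IsProbabilityMeasure P]
  {α β : Measure X} [IsProbabilityMeasure α] [IsProbabilityMeasure β] {η : ℕ → ℝ} {n : ℕ → ℕ}

/-- The potential before an update is independent of the batch used for the update. -/
lemma exists_indepFun_batch (hC : Continuous fun p : X × X => C p.1 p.2)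
    (hn : ∀ t, n t ≠ 0) (hη0 : ∀ t, 0 ≤ η t) (hη1 : ∀ t, η t ≤ 1)
    {x y : ℕ → Ω → X} (hx : ∀ i, Measurable (x i)) (hy : ∀ i, Measurable (y i))
    (hindep : iIndepFun (fun i ω => (x i ω, y i ω)) P)
    {f₀ g₀ : Ω → C(X, ℝ)} (hf₀ : Measurable f₀) (hg₀ : Measurable g₀)
    (hinit : IndepFun (fun ω => (f₀ ω, g₀ ω)) (fun ω i => (x i ω, y i ω)) P) :
    ∃ φ : ℕ → Ω → C(X, ℝ), (∀ t ω b, φ t ω b = Real.exp ((iterates C η n (fun i => x i ω)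
      (fun i => y i ω) (f₀ ω) (g₀ ω) t).2 b)) ∧ (∀ t, Measurable (φ t)) ∧
      ∀ t, IndepFun (φ t) (fun ω (i : batchIndices n t) => y i ω) P := by
  -- The index `none` carries the initial potentials. A pair stays together, since `x i` and `y i`
  -- may depend on each other.
  set m : Option ℕ → MeasurableSpace Ω := fun j =>
    j.elim (MeasurableSpace.comap (fun ω => (f₀ ω, g₀ ω)) inferInstance)
      fun i => MeasurableSpace.comap (fun ω => (x i ω, y i ω)) inferInstance with hm
  have hmle : ∀ j, m j ≤ ‹MeasurableSpace Ω› := by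
    rintro (_ | i)
    · exact (hf₀.prodMk hg₀).comap_le
    · exact ((hx i).prodMk (hy i)).comap_le
  have hmind : iIndep m P := iIndep_option_elim_comap hindep hinit
  -- The past of iteration `t`; the condition is vacuous for `none`, so the initial potentials
  -- always belong to it. `T t` collects the samples not yet used.
  set S : ℕ → Set (Option ℕ) := fun t => {j | ∀ i, j = some i → i < samplesBefore n t} with hS
  set T : ℕ → Set (Option ℕ) := fun t => {j | ∃ i, j = some i ∧ samplesBefore n t ≤ i} with hT
  set 𝓖 : ℕ → MeasurableSpace Ω := fun t => ⨆ j ∈ S t, m j with h𝓖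
  have hST : ∀ t, Disjoint (S t) (T t) := fun t => by
    rw [Set.disjoint_left]
    rintro j hj ⟨i, rfl, hi⟩
    exact absurd (hj i rfl) (not_lt.2 hi)
  have h𝓖mono : ∀ t, 𝓖 t ≤ 𝓖 (t + 1) := fun t => biSup_mono fun j hj i hi =>
    (hj i hi).trans_le (by rw [samplesBefore_succ]; exact Nat.le_add_right _ _)
  have hpair : ∀ i, Measurable[m (some i)] fun ω => (x i ω, y i ω) := fun i =>
    comap_measurable _
  have hpast : ∀ t, ∀ i ∈ batchIndices n t, Measurable[𝓖 (t + 1)] fun ω => (x i ω, y i ω) := by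
    intro t i hi
    have hiS : some i ∈ S (t + 1) := by
      intro i' h'
      rw [← Option.some_injective _ h']
      exact (Finset.mem_Ico.1 hi).2
    exact (hpair i).mono (le_biSup m hiS) le_rfl
  set F : ℕ → Ω → C(X, ℝ) := fun t ω => ⟨_, (continuous_iterates hC hn hη0 hη1 (fun i => x i ω)
    (fun i => y i ω) (f₀ ω).continuous (g₀ ω).continuous t).1⟩ with hF
  set G : ℕ → Ω → C(X, ℝ) := fun t ω => ⟨_, (continuous_iterates hC hn hη0 hη1 (fun i => x i ω)
    (fun i => y i ω) (f₀ ω).continuous (g₀ ω).continuous t).2⟩ with hG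
  have hFG : ∀ t, Measurable[𝓖 t] (F t) ∧ Measurable[𝓖 t] (G t) := by
    intro t
    induction t with
    | zero =>
      have h0 : none ∈ S 0 := fun i hi => by cases hi
      have h1 : Measurable[𝓖 0] fun ω => (f₀ ω, g₀ ω) :=
        Measurable.mono (comap_measurable _) (le_biSup m h0) le_rfl
      exact ⟨measurable_fst.comp h1, measurable_snd.comp h1⟩
    | succ t ih =>
      have h1 : Measurable[𝓖 (t + 1)] (F t) := ih.1.mono (h𝓖mono t) le_rfl
      have h2 : Measurable[𝓖 (t + 1)] (G t) := ih.2.mono (h𝓖mono t) le_rfl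
      refine ⟨measurable_update (m := 𝓖 (t + 1)) hC (hη0 t) (hη1 t) hn h1 h2
          (fun i hi => measurable_snd.comp (hpast t i hi)) fun ω a => ?_,
        measurable_update (m := 𝓖 (t + 1)) (C := flip C) (hC.comp continuous_swap) (hη0 t) (hη1 t)
          hn h2 h1 (fun i hi => measurable_fst.comp (hpast t i hi)) fun ω a => ?_⟩
      · exact iterates_fst_succ hn _ _ _ _ t a
      · have := iterates_fst_succ (C := flip C) (η := η) hn (fun i => y i ω) (fun i => x i ω)
          (g₀ ω) (f₀ ω) t a
        rw [iterates_flip, iterates_flip] at this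
        exact this
  set e : C(ℝ, ℝ) := ⟨Real.exp, Real.continuous_exp⟩ with he
  have hφ : ∀ t, Measurable[𝓖 t] fun ω => e.comp (G t ω) := fun t =>
    (ContinuousMap.continuous_postcomp e).measurable.comp (hFG t).2
  have h𝓖le : ∀ t, 𝓖 t ≤ ‹MeasurableSpace Ω› := fun t => iSup₂_le fun j _ => hmle j
  refine ⟨fun t ω => e.comp (G t ω), fun t ω b => rfl, fun t => (hφ t).mono (h𝓖le t) le_rfl,
    fun t => ?_⟩
  have hbatch : Measurable[⨆ j ∈ T t, m j] fun ω (i : batchIndices n t) => y i ω := by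
    refine @measurable_pi_lambda _ _ _ (⨆ j ∈ T t, m j) _ _ fun i => ?_
    have hiT : some (i : ℕ) ∈ T t := ⟨i, rfl, (Finset.mem_Ico.1 i.2).1⟩
    exact measurable_snd.comp ((hpair i).mono (le_biSup m hiT) le_rfl)
  exact indep_of_indep_of_le_right (indep_of_indep_of_le_left
    (indep_iSup_of_disjoint hmle hmind (hST t)) (hφ t).comap_le) hbatch.comap_le

/-- The sampling errors of the `g`-potentials are almost surely summable on average. -/
lemma ae_summable_samplingError (hC : Continuous fun p : X × X => C p.1 p.2)
    {w : ℕ → ℝ} {B : ℝ} (hB : 0 < B) (hw : ∀ t, 0 < w t)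
    (hn : ∀ t, (n t : ℝ) = B / w t ^ 2) (hη0 : ∀ t, 0 ≤ η t) (hη1 : ∀ t, η t ≤ 1)
    (hwη : Summable fun t => w t * η t)
    {x y : ℕ → Ω → X} (hx : ∀ i, Measurable (x i)) (hy : ∀ i, Measurable (y i))
    (hyβ : ∀ i, P.map (y i) = β)
    (hindep : iIndepFun (fun i ω => (x i ω, y i ω)) P)
    {f₀ g₀ : Ω → C(X, ℝ)} (hf₀ : Measurable f₀) (hg₀ : Measurable g₀)
    (hinit : IndepFun (fun ω => (f₀ ω, g₀ ω)) (fun ω i => (x i ω, y i ω)) P)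
    {f g : X → ℝ} (h : IsOptimalPotentials C α β f g) (x₀ : X)
    (ρ : Measure X) [IsProbabilityMeasure ρ] :
    ∀ᵐ ω ∂P, Summable fun t => η t * (Real.exp (g x₀ - (iterates C η n (fun i => x i ω)
        (fun i => y i ω) (f₀ ω) (g₀ ω) t).2 x₀) *
      ∫ a, |samplingError (fun x y => Real.exp (f x + g y - C x y)) β
        (batchMeasure n (fun i => y i ω) t) (fun b => Real.exp (g b - (iterates C η n
          (fun i => x i ω) (fun i => y i ω) (f₀ ω) (g₀ ω) t).2 b)) a| ∂ρ) := by
  have hn0 : ∀ t, n t ≠ 0 := fun t h0 => by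
    have h1 := hn t
    have h2 := hw t
    rw [h0, Nat.cast_zero] at h1
    exact (div_pos hB (pow_pos h2 2)).ne h1
  obtain ⟨φ, hφeq, hφm, hφi⟩ := exists_indepFun_batch (P := P) hC hn0 hη0 hη1 hx hy hindep hf₀ hg₀
    hinit
  have hyind : iIndepFun y P := hindep.comp (fun _ p => p.2) fun _ => measurable_snd
  have hsum := ae_summable_sampling_error hB hw hn hη0 hwη hy hyβ hyind
    (k := fun a b => Real.exp (-C a b)) (by fun_prop) hφm hφi ρ
  filter_upwards [hsum] with ω hω
  have (z : ℕ → X) (t : ℕ) : IsProbabilityMeasure (batchMeasure n z t) :=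
    isProbabilityMeasure_batchMeasure (hn0 t) z
  obtain ⟨δ, Λ, hrel⟩ := h.exists_relativeIterates hC hn0 hη0 hη1 (fun i => x i ω) (fun i => y i ω)
    (f₀ ω).continuous (g₀ ω).continuous
  exact hrel.summable_samplingError h.continuous_left h.continuous_right (fun t => φ t ω)
    (fun t b => hφeq t ω b) x₀ hω

end Independence

end OnlineSinkhorn

theorem mainTheorem1
    {X : Type*} [MetricSpace X] [CompactSpace X] [MeasurableSpace X] [BorelSpace X]
    [MeasurableSpace C(X, ℝ)] [BorelSpace C(X, ℝ)]
    (C : X → X → ℝ) (L : NNReal) (hC : LipschitzWith L (fun p : X × X => C p.1 p.2))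
    (α β : Measure X) [IsProbabilityMeasure α] [IsProbabilityMeasure β]
    (fstar gstar : X → ℝ) (hopt : OnlineSinkhorn.IsOptimalPotentials C α β fstar gstar)
    -- step sizes and batch sizes
    (η w : ℕ → ℝ) (B : ℝ) (n : ℕ → ℕ)
    (hB : 0 < B) (hw : ∀ t, 0 < w t) (hn : ∀ t, (n t : ℝ) = B / w t ^ 2)
    (hη0 : ∀ t, 0 ≤ η t) (hη1 : ∀ t, η t ≤ 1)
    (hwη : Summable (fun t => w t * η t))
    (hη : Tendsto (fun T => ∑ t ∈ Finset.range T, η t) atTop atTop)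
    -- sample streams and initial potentials
    {Ω : Type*} [MeasurableSpace Ω] (P : Measure Ω) [IsProbabilityMeasure P]
    (x y : ℕ → Ω → X) (hx : ∀ i, Measurable (x i)) (hy : ∀ i, Measurable (y i))
    (hxα : ∀ i, P.map (x i) = α) (hyβ : ∀ i, P.map (y i) = β)
    (hindep : iIndepFun (fun i ω => (x i ω, y i ω)) P)
    (f₀ g₀ : Ω → C(X, ℝ)) (hf₀ : Measurable f₀) (hg₀ : Measurable g₀)
    (hinit : IndepFun (fun ω => (f₀ ω, g₀ ω)) (fun ω i => (x i ω, y i ω)) P) :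
    ∀ᵐ ω ∂P, Tendsto
      (fun t =>
        OnlineSinkhorn.varNorm (fun a =>
          (OnlineSinkhorn.iterates C η n (fun i => x i ω) (fun i => y i ω) (f₀ ω) (g₀ ω) t).1 a
            - fstar a)
        + OnlineSinkhorn.varNorm (fun b =>
          (OnlineSinkhorn.iterates C η n (fun i => x i ω) (fun i => y i ω) (f₀ ω) (g₀ ω) t).2 b
            - gstar b))
      atTop (𝓝 0) := by
  open OnlineSinkhorn in
  have hX : Nonempty X := nonempty_of_isProbabilityMeasure α
  have x₀ : X := hX.some
  have hn0 : ∀ t, n t ≠ 0 := fun t h0 => by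
    have h1 := hn t
    have h2 := hw t
    rw [h0, Nat.cast_zero] at h1
    exact (div_pos hB (pow_pos h2 2)).ne h1
  have hCc := hC.continuous
  have hindep' : iIndepFun (fun i ω => (y i ω, x i ω)) P :=
    hindep.comp (fun _ p => p.swap) fun _ => measurable_swap
  have hinit' : IndepFun (fun ω => (g₀ ω, f₀ ω)) (fun ω i => (y i ω, x i ω)) P :=
    IndepFun.comp (φ := Prod.swap) (ψ := fun (v : ℕ → X × X) i => (v i).swap) hinit measurable_swap
      (measurable_pi_lambda _ fun i => measurable_swap.comp (measurable_pi_apply i))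
  -- The measure `ρ` stays free: `α` and `β` serve the bounds on the scale, Dirac masses the
  -- pointwise errors on a dense set.
  have hβsum := fun (ρ : Measure X) [IsProbabilityMeasure ρ] => ae_summable_samplingError hCc hB hw
    hn hη0 hη1 hwη hx hy hyβ hindep hf₀ hg₀ hinit hopt x₀ ρ
  have hαsum := fun (ρ : Measure X) [IsProbabilityMeasure ρ] => ae_summable_samplingError
    (C := flip C) (hCc.comp continuous_swap) hB hw hn hη0 hη1 hwη hy hx hxα hindep' hg₀ hf₀ hinit'
    hopt.symm x₀ ρ
  simp only [iterates_flip, Prod.snd_swap] at hαsum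
  -- Countability lets the exceptional null sets be united.
  obtain ⟨S, hScount, hSdense⟩ := TopologicalSpace.exists_countable_dense X
  filter_upwards [hβsum α, hαsum β, (ae_ball_iff hScount).2 fun q _ => hβsum (Measure.dirac q),
    (ae_ball_iff hScount).2 fun q _ => hαsum (Measure.dirac q)] with ω h1 h2 h3 h4
  have (z : ℕ → X) (t : ℕ) : IsProbabilityMeasure (batchMeasure n z t) :=
    isProbabilityMeasure_batchMeasure (hn0 t) z
  obtain ⟨δ, Λ, hrel⟩ := hopt.exists_relativeIterates hCc hn0 hη0 hη1 (fun i => x i ω)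
    (fun i => y i ω) (f₀ ω).continuous (g₀ ω).continuous
  have hflip : (fun x y => Real.exp (gstar x + fstar y - flip C x y))
      = flip fun x y => Real.exp (fstar x + gstar y - C x y) := by
    funext x y; simp only [flip, add_comm]
  rw [hflip] at h2 h4
  simp only [integral_dirac] at h3 h4
  have hcont := continuous_iterates hCc hn0 hη0 hη1 (fun i => x i ω) (fun i => y i ω)
    (f₀ ω).continuous (g₀ ω).continuous
  rw [Metric.tendsto_nhds]
  intro ε hε
  filter_upwards [hrel.eventually_le_mul x₀ hη hSdense h1 h2 h3 h4 (by positivity : 0 < ε / 3)]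
    with t ht
  have hv1 := varNorm_sub_le_of_exp_le fun x x' => (ht x x').1
  have hv2 := varNorm_sub_le_of_exp_le fun x x' => (ht x x').2
  have hp1 := varNorm_nonneg ((hcont t).1.sub hopt.continuous_left)
  have hp2 := varNorm_nonneg ((hcont t).2.sub hopt.continuous_right)
  rw [Real.dist_eq, sub_zero]
  refine (abs_of_nonneg (add_nonneg hp1 hp2)).trans_lt ((add_le_add hv1 hv2).trans_lt ?_)
  linarith
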